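/- Let $\mathcal L$ be an algebraic signature (finitary operation symbols) with at least one constant symbol, and let $\mathcal V$ be a variety of $\mathcal L$-algebras with the congruence extension property: every congruence on a subalgebra of an algebra $\mathbf A\in\mathcal V$ is the restriction of a congruence on $\mathbf A$. **Notation.** $\overline x,\overline y,\overline z$ denote pairwise disjoint sets of variables, and $\Sigma(\overline x,\overline y)$ denotes a set of equations whose variables lie in $\overline x\cup\overline y$. For sets of equations, $\Sigma\models_{\mathcal V}\Delta$ means that in every algebra in $\mathcal V$, every assignment satisfying all equations in $\Sigma$ satisfies all equations in $\Delta$. $\mathbf F(\overline x)$ is the $\mathcal V$-free algebra over $\overline x$. An algebra $\mathbf A \in \mathcal V$ is finitely presented if there are a finite set $\overline x$ and a surjective homomorphism $\mathbf F(\overline x)\to\mathbf A$ whose kernel is a compact element of the congruence lattice of $\mathbf F(\overline x)$. $\mathrm{KCon}\,\mathbf A$ is the set of compact congruences on $\mathbf A$, ordered by inclusion. Finite meets and finite joins include the empty ones, i.e. a greatest and a least element, respectively. **r-Heyting categories.** A category is *r-regular* if it has finite limits, each arrow factorizes as an epimorphism followed by a regular monomorphism, and epimorphisms are stable under pullback.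 It is *r-Heyting* if moreover, for each object $X$, finite joins exist in the ordered set of regular subobjects of $X$, and for each arrow $f\colon X\to Y$, the pullback map along $f$ from regular subobjects of $Y$ to regular subobjects of $X$ has a right adjoint. **Uniform interpolation.** * $\mathcal V$ admits *right uniform deductive interpolation* if for any finite sets $\overline x,\overline y$ and finite set of equations $\Sigma(\overline x,\overline y)$ there is a finite set of equations $\Pi(\overline y)$ such that $\Sigma\models_{\mathcal V}\Pi$ and, for any $\overline z$ and any equation $\varepsilon(\overline y,\overline z)$, $\Sigma\models_{\mathcal V}\varepsilon$ implies $\Pi\models_{\mathcal V}\varepsilon$. * $\mathcal V$ admits *left uniform deductive interpolation* if for any finite sets $\overline y,\overline z$ and finite set of equations $\Delta(\overline y,\overline z)$ there is a finite set of equations $\Pi(\overline y)$ such that $\Pi\models_{\mathcal V}\Delta$ and, for any $\overline x$ and any set of equations $\Sigma(\overline x,\overline y)$, $\Sigma\models_{\mathcal V}\Delta$ implies $\Sigma\models_{\mathcal V}\Pi$. * $\mathcal V$ admits *right uniform Maehara interpolation* if for any finite sets $\overline x,\overline y$ and finite set of equations $\Gamma(\overline x,\overline y)$ there is a finite set of equations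 $\Pi(\overline y)$ such that, for any $\overline z$ and any finite sets of equations $\Sigma(\overline y,\overline z),\Delta(\overline y,\overline z)$, $\Gamma,\Sigma\models_{\mathcal V}\Delta$ if and only if $\Pi,\Sigma\models_{\mathcal V}\Delta$. * $\mathcal V$ admits *left uniform Maehara interpolation* if for any finite sets $\overline y,\overline z$ and finite sets of equations $\Sigma(\overline y,\overline z),\Delta(\overline y,\overline z)$ there is a finite set of equations $\Pi(\overline y)$ such that, for any $\overline x$ and any finite set of equations $\Gamma(\overline x,\overline y)$, $\Gamma,\Sigma\models_{\mathcal V}\Delta$ if and only if $\Gamma\models_{\mathcal V}\Pi$. **Proposition.** The following are equivalent: 1. The opposite of the category of finitely presented algebras in $\mathcal V$ (with all homomorphisms) is an r-Heyting category. 2. $\mathcal V$ admits left and right uniform deductive interpolation, and for every finitely presented $\mathbf A\in\mathcal V$ the order dual of $\mathrm{KCon}\,\mathbf A$ is a Heyting algebra. 3. $\mathcal V$ admits left and right uniform Maehara interpolation, and for every finitely presented $\mathbf A\in\mathcal V$ the ordered set $\mathrm{KCon}\,\mathbf A$ has all finite meets. -/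

import Mathlib

open CategoryTheory CategoryTheory.Limits

universe u v w w'

namespace UnivAlg

/-! ### Congruences

An algebraic signature is a first-order language `L` without relation symbols, an algebra of that
signature is an `L`-structure, and homomorphisms and subalgebras are `L.Hom` and `L.Substructure`.
-/

/-- A congruence on the algebra `A`. -/
@[ext]
structure Congr (L : FirstOrder.Language.{u, v}) (A : Type w) [L.Structure A] where
  rel : A → A → Prop
  equivalence : Equivalence rel
  compat : ∀ {n : ℕ} (f : L.Functions n) (x y : Fin n → A),
    (∀ i, rel (x i) (y i)) →
      rel (FirstOrder.Language.Structure.funMap f x) (FirstOrder.Language.Structure.funMap f y)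

namespace Congr

variable {L : FirstOrder.Language.{u, v}} {A : Type w} [L.Structure A]

/-- Congruences are ordered by inclusion. -/
instance : PartialOrder (Congr L A) where
  le θ ψ := ∀ a b, θ.rel a b → ψ.rel a b
  le_refl _ _ _ h := h
  le_trans _ _ _ h₁ h₂ a b h := h₂ a b (h₁ a b h)
  le_antisymm θ ψ h₁ h₂ := by
    ext a b
    exact ⟨h₁ a b, h₂ a b⟩

/-- The underlying equivalence relation of a congruence. -/
def toSetoid (θ : Congr L A) : Setoid A := ⟨θ.rel, θ.equivalence⟩

/-- The algebra structure descends to the quotient; with this instance, Mathlib's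
`FirstOrder.Language.quotientStructure` makes `Quotient θ.toSetoid` the quotient algebra. -/
instance [L.IsAlgebraic] (θ : Congr L A) : L.Prestructure θ.toSetoid where
  toStructure := inferInstance
  fun_equiv {_ f} x y h := θ.compat f x y h
  rel_equiv {_ r} _ _ _ := isEmptyElim r

/-- The kernel of a homomorphism. -/
def ker {B : Type w'} [L.Structure B] (h : FirstOrder.Language.Hom L A B) : Congr L A where
  rel a b := h a = h b
  equivalence := ⟨fun _ => rfl, fun e => e.symm, fun e₁ e₂ => e₁.trans e₂⟩
  compat f x y e := by
    rw [FirstOrder.Language.HomClass.map_fun, FirstOrder.Language.HomClass.map_fun]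
    exact congrArg _ (funext e)

end Congr

/-- The compact congruences on `A`, ordered by inclusion. -/
abbrev KCon (L : FirstOrder.Language.{u, v}) (A : Type w) [L.Structure A] : Type w :=
  {θ : Congr L A // IsCompactElement θ}

/-! ### Terms and equations -/

/-- The term algebra over the set of variables `X`. -/
instance termStructure (L : FirstOrder.Language.{u, v}) [L.IsAlgebraic] (X : Type w) :
    L.Structure (L.Term X) where
  funMap f ts := FirstOrder.Language.Term.func f ts
  RelMap r _ := isEmptyElim r

/-- An equation with variables in `X`. -/
abbrev Equation (L : FirstOrder.Language.{u, v}) (X : Type w) : Type (max u w) :=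
  L.Term X × L.Term X

/-- The assignment `f` satisfies the equation `e` in the algebra `A`. -/
def Equation.Holds {L : FirstOrder.Language.{u, v}} {X : Type w} (e : Equation L X) {A : Type w'}
    [L.Structure A] (f : X → A) : Prop :=
  e.1.realize f = e.2.realize f

/-- The set of equations `S` with its variables renamed along `g`. It is used only with inclusions
`g` of a set of variables into a disjoint union, to view equations in the variables `X` as equations
in a larger set of variables. -/
def rename {L : FirstOrder.Language.{u, v}} {X : Type w} {Y : Type w'} (g : X → Y)
    (S : Set (Equation L X)) : Set (Equation L Y) :=
  (fun e => (e.1.relabel g, e.2.relabel g)) '' S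

/-! ### Varieties -/

/-- A variety of `L`-algebras, given by a set of defining equations. -/
structure Variety (L : FirstOrder.Language.{u, v}) where
  identities : Set (Equation L ℕ)

namespace Variety

variable {L : FirstOrder.Language.{u, v}} (V : Variety L)

/-- The algebra `A` belongs to the variety `V`. -/
def Mem (A : Type w) [L.Structure A] : Prop :=
  ∀ e ∈ V.identities, ∀ f : ℕ → A, e.Holds f

/-- Equational consequence in `V`: in each algebra in `V`, each assignment that satisfies all
equations in `S` satisfies all equations in `D`. -/
def Entails {X : Type w} (S D : Set (Equation L X)) : Prop :=
  ∀ (A : Type u) [L.Structure A], V.Mem A →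
    ∀ f : X → A, (∀ e ∈ S, e.Holds f) → ∀ e ∈ D, e.Holds f

/-- The congruence on the term algebra over `X` that relates `t` and `s` when the equation `t ≈ s`
is valid in `V`. -/
def validCongr [L.IsAlgebraic] (X : Type w) : Congr L (L.Term X) where
  rel t s := V.Entails ∅ {(t, s)}
  equivalence := by
    refine ⟨fun t A _ _ f _ e he => ?_, fun {t s} h A _ hA f hf e he => ?_,
      fun {t s r} h₁ h₂ A _ hA f hf e he => ?_⟩
    · rw [Set.mem_singleton_iff.1 he]
      rfl
    · rw [Set.mem_singleton_iff.1 he]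
      exact (h A hA f hf _ rfl).symm
    · rw [Set.mem_singleton_iff.1 he]
      exact (h₁ A hA f hf _ rfl).trans (h₂ A hA f hf _ rfl)
  compat g x y h A _ hA f hf e he := by
    rw [Set.mem_singleton_iff.1 he]
    exact congrArg (FirstOrder.Language.Structure.funMap g)
      (funext fun i => h i A hA f hf _ rfl)

/-- The `V`-free algebra over `X`, as a quotient of the term algebra. -/
abbrev FreeAlgebra [L.IsAlgebraic] (X : Type w) : Type (max u w) :=
  Quotient (V.validCongr X).toSetoid

/-- `A` is finitely presented: it is the image of a free algebra over a finite set under a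
homomorphism with compact kernel. -/
def FinitelyPresented [L.IsAlgebraic] (A : Type u) [L.Structure A] : Prop :=
  ∃ (X : Type) (_ : Finite X) (p : FirstOrder.Language.Hom L (V.FreeAlgebra X) A),
    Function.Surjective p ∧ IsCompactElement (Congr.ker p)

/-- The congruence extension property: each congruence on a subalgebra `S` of an algebra `A` in `V`
is the restriction to `S` of a congruence on `A`. -/
def CongruenceExtension : Prop :=
  ∀ (A : Type u) [L.Structure A], V.Mem A →
    ∀ (S : L.Substructure A) (θ : Congr L S), ∃ ψ : Congr L A,
      ∀ a b : S, θ.rel a b ↔ ψ.rel a b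

/-! ### Uniform interpolation

Pairwise disjoint sets of variables are types `X`, `Y`, `Z`, and unions are sums of types. -/

/-- Right uniform deductive interpolation. -/
def RightUniformDeductive : Prop :=
  ∀ (X Y : Type) [Finite X] [Finite Y] (S : Set (Equation L (X ⊕ Y))), S.Finite →
    ∃ P : Set (Equation L Y), P.Finite ∧
      V.Entails S (rename Sum.inr P) ∧
      ∀ (Z : Type) (e : Equation L (Y ⊕ Z)),
        V.Entails (X := X ⊕ (Y ⊕ Z)) (rename (Sum.map id Sum.inl) S) (rename Sum.inr {e}) →
          V.Entails (rename Sum.inl P) {e}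

/-- Left uniform deductive interpolation. -/
def LeftUniformDeductive : Prop :=
  ∀ (Y Z : Type) [Finite Y] [Finite Z] (D : Set (Equation L (Y ⊕ Z))), D.Finite →
    ∃ P : Set (Equation L Y), P.Finite ∧
      V.Entails (rename Sum.inl P) D ∧
      ∀ (X : Type) (S : Set (Equation L (X ⊕ Y))),
        V.Entails (X := X ⊕ (Y ⊕ Z)) (rename (Sum.map id Sum.inl) S) (rename Sum.inr D) →
          V.Entails S (rename Sum.inr P)

/-- Right uniform Maehara interpolation. -/
def RightUniformMaehara : Prop :=
  ∀ (X Y : Type) [Finite X] [Finite Y] (G : Set (Equation L (X ⊕ Y))), G.Finite →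
    ∃ P : Set (Equation L Y), P.Finite ∧
      ∀ (Z : Type) (S D : Set (Equation L (Y ⊕ Z))), S.Finite → D.Finite →
        (V.Entails (X := X ⊕ (Y ⊕ Z))
            (rename (Sum.map id Sum.inl) G ∪ rename Sum.inr S) (rename Sum.inr D) ↔
          V.Entails (rename Sum.inl P ∪ S) D)

/-- Left uniform Maehara interpolation. -/
def LeftUniformMaehara : Prop :=
  ∀ (Y Z : Type) [Finite Y] [Finite Z] (S D : Set (Equation L (Y ⊕ Z))), S.Finite → D.Finite →
    ∃ P : Set (Equation L Y), P.Finite ∧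
      ∀ (X : Type) (G : Set (Equation L (X ⊕ Y))), G.Finite →
        (V.Entails (X := X ⊕ (Y ⊕ Z))
            (rename (Sum.map id Sum.inl) G ∪ rename Sum.inr S) (rename Sum.inr D) ↔
          V.Entails G (rename Sum.inr P))

end Variety

/-! ### The category of finitely presented algebras -/

/-- A finitely presented algebra in the variety `V`. -/
structure FPAlg {L : FirstOrder.Language.{u, v}} [L.IsAlgebraic] (V : Variety L) where
  carrier : Type u
  [str : L.Structure carrier]
  mem : V.Mem carrier
  finitelyPresented : V.FinitelyPresented carrier

attribute [instance] FPAlg.str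

/-- Finitely presented algebras in `V` form a category, with all homomorphisms as morphisms. -/
instance {L : FirstOrder.Language.{u, v}} [L.IsAlgebraic] (V : Variety L) :
    Category.{u} (FPAlg V) where
  Hom A B := FirstOrder.Language.Hom L A.carrier B.carrier
  id A := FirstOrder.Language.Hom.id L A.carrier
  comp f g := g.comp f

/-! ### Order-theoretic notions -/

/-- All finite meets exist in `P`, including the empty one (a greatest element). -/
def HasFiniteMeets (P : Type w) [PartialOrder P] : Prop :=
  ∀ s : Set P, s.Finite → ∃ m, IsGLB s m

/-- All finite joins exist in `P`, including the empty one (a least element). -/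
def HasFiniteJoins (P : Type w) [PartialOrder P] : Prop :=
  ∀ s : Set P, s.Finite → ∃ j, IsLUB s j

/-- The order dual of the partially ordered set `P` is a Heyting algebra. -/
def IsDualHeyting (P : Type w) [PartialOrder P] : Prop :=
  ∃ H : HeytingAlgebra Pᵒᵈ, ∀ a b : Pᵒᵈ, H.le a b ↔ a ≤ b

/-! ### r-Heyting categories -/

section Categories

variable (C : Type w) [Category.{w'} C]

/-- An r-regular category: finite limits exist, each arrow is an epimorphism followed by a regular
monomorphism, and epimorphisms are stable under pullback. -/
structure IsRRegular : Prop where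
  hasFiniteLimits : HasFiniteLimits C
  exists_factorization : ∀ {X Y : C} (f : X ⟶ Y),
    ∃ (I : C) (e : X ⟶ I) (m : I ⟶ Y), Epi e ∧ IsRegularMono m ∧ e ≫ m = f
  epi_stable : (MorphismProperty.epimorphisms C).IsStableUnderBaseChange

variable {C}

/-- The partially ordered set of regular subobjects of `X`. -/
abbrev RegSubobject (X : C) : Type (max w w') :=
  {S : Subobject X // IsRegularMono S.arrow}

/-- Pullback of regular subobjects along `f`. -/
noncomputable def RegSubobject.pullback [HasPullbacks C] {X Y : C} (f : X ⟶ Y)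
    (S : RegSubobject Y) : RegSubobject X :=
  ⟨(Subobject.pullback f).obj S.1,
    have := S.2
    ⟨⟨regularOfIsPullbackSndOfRegular (IsRegularMono.getStruct S.1.arrow)
      (Subobject.isPullback f S.1).w (Subobject.isPullback f S.1).isLimit⟩⟩⟩

variable (C)

/-- An r-Heyting category: an r-regular category in which finite joins of regular subobjects exist
and the pullback functors on regular subobjects have right adjoints. -/
structure IsRHeyting : Prop extends IsRRegular C where
  finite_joins : ∀ X : C, HasFiniteJoins (RegSubobject X)
  exists_right_adjoint :
    haveI := hasFiniteLimits
    ∀ {X Y : C} (f : X ⟶ Y), ∃ g : RegSubobject X → RegSubobject Y,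
      GaloisConnection (RegSubobject.pullback f) g

end Categories

end UnivAlg

/-! Everything is read through presentations. Over an algebra presented by generators `a` and
relations `S`, finite sets of equations describe exactly the compact congruences, and inclusion of
congruences is consequence modulo `S` (`IsPres.gen_le_gen_iff`). A pushout of presented algebras is
presented by the union of the relations over the shared generators (`isPushout_of_isPres`), which is
the premise `Γ, Σ` of Maehara interpolation.

For 1 ⇔ 3, the r-Heyting axioms are dualized. Epimorphisms in the opposite category are injective
homomorphisms, and regular subobjects of `A` are its compact congruences with the order reversed;
pullback becomes the congruence generated by the image. So 1 says (`isRHeyting_op_iff`,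
`DualRHeyting`): kernels are compact, pushouts preserve injectivity, compact congruences have finite
meets, and for a homomorphism `h` and a compact `ψ` there is a least compact `φ` whose image under
`h` generates a congruence above `ψ`. The first two conditions amount to right Maehara
interpolation: `Π` generates the kernel of the map from the free algebra over `y` to the algebra
presented by `Γ`, and injectivity in pushouts lets side equations be added. Given these, the last
condition is left Maehara interpolation. The meets appear on both sides.

For 3 ⇒ 2, empty side equations give the deductive properties, and left Maehara interpolation with
no variables `z` gives the difference operation on compact congruences. For 2 ⇒ 3, the congruence
extension property upgrades right deductive to right Maehara interpolation
(`RightUniformDeductive.rightUniformMaehara`). The left property follows by forming the difference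
of `Δ` and `Σ` in a free algebra and interpolating it (`LeftUniformDeductive.leftUniformMaehara`).
-/

namespace UnivAlg

open FirstOrder FirstOrder.Language FirstOrder.Language.Structure

/-! ### Generated congruences and quotients -/

section Congruences

variable {L : FirstOrder.Language.{u, v}} {A : Type w} [L.Structure A]

namespace Congr

/-- The congruence generated by a set of pairs. -/
def gen (L : FirstOrder.Language.{u, v}) {A : Type w} [L.Structure A] (R : Set (A × A)) :
    Congr L A where
  rel a b := ∀ θ : Congr L A, (∀ p ∈ R, θ.rel p.1 p.2) → θ.rel a b
  equivalence := ⟨fun a θ _ => θ.equivalence.refl a, fun h θ hθ => θ.equivalence.symm (h θ hθ),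
    fun h₁ h₂ θ hθ => θ.equivalence.trans (h₁ θ hθ) (h₂ θ hθ)⟩
  compat f x y h θ hθ := θ.compat f x y fun i => h i θ hθ

theorem gen_le {R : Set (A × A)} {θ : Congr L A} : gen L R ≤ θ ↔ ∀ p ∈ R, θ.rel p.1 p.2 :=
  ⟨fun h p hp => h p.1 p.2 fun _ hψ => hψ p hp, fun h _ _ hab => hab θ h⟩

theorem rel_gen {R : Set (A × A)} {p : A × A} (hp : p ∈ R) : (gen L R).rel p.1 p.2 :=
  gen_le.1 le_rfl p hp

/-- The union of a directed set of congruences. -/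
def directedUnion (s : Set (Congr L A)) (hne : s.Nonempty) (hs : DirectedOn (· ≤ ·) s) :
    Congr L A where
  rel a b := ∃ θ ∈ s, θ.rel a b
  equivalence := by
    refine ⟨fun a => ?_, fun ⟨θ, hθ, h⟩ => ⟨θ, hθ, θ.equivalence.symm h⟩, ?_⟩
    · obtain ⟨θ, hθ⟩ := hne
      exact ⟨θ, hθ, θ.equivalence.refl a⟩
    · rintro a b c ⟨θ, hθ, hab⟩ ⟨ψ, hψ, hbc⟩
      obtain ⟨χ, hχ, h₁, h₂⟩ := hs θ hθ ψ hψ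
      exact ⟨χ, hχ, χ.equivalence.trans (h₁ _ _ hab) (h₂ _ _ hbc)⟩
  compat {n} f x y h := by
    choose θ hθ hxy using h
    have := directedOn_iff_directed.1 hs
    have : Nonempty s := hne.to_subtype
    obtain ⟨ψ, hψ⟩ := (directedOn_iff_directed.1 hs).finite_le (fun i : Fin n => ⟨θ i, hθ i⟩)
    exact ⟨ψ, ψ.2, ψ.1.compat f x y fun i => hψ i _ _ (hxy i)⟩

/-- Operations are finitary, so a directed join of congruences is their union: each generating pair
lies in some member, and finitely many members have a common upper bound. -/
theorem isCompactElement_gen {R : Set (A × A)} (hR : R.Finite) : IsCompactElement (gen L R) := by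
  intro s u hne hs hu hle
  have hu' : u ≤ directedUnion s hne hs := hu.2 fun θ hθ a b h => ⟨θ, hθ, h⟩
  have hmem : ∀ p : R, ∃ θ : s, θ.1.rel p.1.1 p.1.2 := fun p => by
    obtain ⟨θ, hθ, h⟩ := hu' _ _ (hle _ _ (rel_gen p.2))
    exact ⟨⟨θ, hθ⟩, h⟩
  choose θ hθ using hmem
  have : Nonempty s := hne.to_subtype
  have : Finite R := hR
  obtain ⟨ψ, hψ⟩ := (directedOn_iff_directed.1 hs).finite_le θ
  exact ⟨ψ, ψ.2, gen_le.2 fun p hp => hψ ⟨p, hp⟩ _ _ (hθ ⟨p, hp⟩)⟩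

theorem gen_mono {R S : Set (A × A)} (h : R ⊆ S) : gen L R ≤ gen L S :=
  gen_le.2 fun _ hp => rel_gen (h hp)

/-- Any congruence is the directed join of the congruences generated by its finite subsets;
compactness puts it below one of them. -/
theorem exists_finite_gen_eq {θ : Congr L A} (hθ : IsCompactElement θ) :
    ∃ R : Set (A × A), R.Finite ∧ gen L R = θ := by
  obtain ⟨_, ⟨R, ⟨hR, hRθ⟩, rfl⟩, hle⟩ :=
    hθ (gen L '' {R | R.Finite ∧ ∀ p ∈ R, θ.rel p.1 p.2}) θ
    ⟨_, ∅, ⟨Set.finite_empty, by simp⟩, rfl⟩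
    (by
      rintro _ ⟨R, ⟨hR, hRθ⟩, rfl⟩ _ ⟨S, ⟨hS, hSθ⟩, rfl⟩
      refine ⟨_, ⟨R ∪ S, ⟨hR.union hS, ?_⟩, rfl⟩, gen_mono Set.subset_union_left,
        gen_mono Set.subset_union_right⟩
      rintro p (hp | hp)
      exacts [hRθ p hp, hSθ p hp])
    ⟨by
      rintro _ ⟨R, ⟨-, hRθ⟩, rfl⟩
      exact gen_le.2 hRθ,
    fun ψ hψ a b hab => hψ ⟨{(a, b)}, ⟨Set.finite_singleton _, by simpa using hab⟩, rfl⟩ a b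
      (rel_gen (p := (a, b)) rfl)⟩
    le_rfl
  exact ⟨R, hR, le_antisymm (gen_le.2 hRθ) hle⟩

end Congr

/-- A function between algebras that preserves the operations is a homomorphism. -/
def homOfFun [L.IsAlgebraic] {B : Type w'} [L.Structure B] (h : A → B)
    (hh : ∀ {n : ℕ} (f : L.Functions n) (x : Fin n → A), h (funMap f x) = funMap f (h ∘ x)) :
    A →[L] B where
  toFun := h
  map_fun' := hh
  map_rel' r := isEmptyElim r

/-- The quotient homomorphism. -/
def Congr.proj [L.IsAlgebraic] (θ : Congr L A) : A →[L] Quotient θ.toSetoid :=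
  homOfFun (fun a => Quotient.mk θ.toSetoid a)
    fun f x => (funMap_quotient_mk' θ.toSetoid f x).symm

theorem Congr.proj_surjective [L.IsAlgebraic] (θ : Congr L A) : Function.Surjective θ.proj :=
  Quotient.mk_surjective

theorem Congr.proj_eq_iff [L.IsAlgebraic] (θ : Congr L A) {a b : A} :
    θ.proj a = θ.proj b ↔ θ.rel a b :=
  Quotient.eq (r := θ.toSetoid)

theorem Congr.ker_proj [L.IsAlgebraic] (θ : Congr L A) : Congr.ker θ.proj = θ := by
  ext a b
  exact θ.proj_eq_iff

/-- A homomorphism factors through a surjective homomorphism with smaller kernel. -/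
theorem exists_factor [L.IsAlgebraic] {B C : Type*} [L.Structure B] [L.Structure C]
    (p : A →[L] B) (hp : Function.Surjective p) (q : A →[L] C)
    (h : ∀ a b, p a = p b → q a = q b) : ∃ r : B →[L] C, ∀ a, r (p a) = q a := by
  choose s hs using hp
  have hr : ∀ a, q (s (p a)) = q a := fun a => h _ _ (hs _)
  refine ⟨homOfFun (fun b => q (s b)) fun f x => ?_, hr⟩
  have hx : funMap f x = p (funMap f (s ∘ x)) := by
    rw [Hom.map_fun]
    congr 1
    funext i
    exact (hs _).symm
  change q (s (funMap f x)) = _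
  rw [hx, hr, Hom.map_fun]
  rfl

/-- The image of a congruence under a homomorphism. -/
def Congr.map {B : Type w'} [L.Structure B] (h : A →[L] B) (θ : Congr L A) : Congr L B :=
  gen L {p | ∃ a b, θ.rel a b ∧ p = (h a, h b)}

theorem Congr.map_le {B : Type w'} [L.Structure B] {h : A →[L] B} {θ : Congr L A}
    {ψ : Congr L B} : θ.map h ≤ ψ ↔ ∀ a b, θ.rel a b → ψ.rel (h a) (h b) := by
  unfold map
  rw [gen_le]
  constructor
  · exact fun H a b hab => H _ ⟨a, b, hab, rfl⟩
  · rintro H _ ⟨a, b, hab, rfl⟩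
    exact H a b hab

/-- The preimage of a congruence under a homomorphism. -/
def Congr.comap {B : Type w'} [L.Structure B] (h : A →[L] B) (ψ : Congr L B) : Congr L A where
  rel a b := ψ.rel (h a) (h b)
  equivalence := ⟨fun _ => ψ.equivalence.refl _, fun e => ψ.equivalence.symm e,
    fun e₁ e₂ => ψ.equivalence.trans e₁ e₂⟩
  compat f x y e := by
    rw [Hom.map_fun, Hom.map_fun]
    exact ψ.compat f _ _ e

theorem Congr.map_gen {B : Type w'} [L.Structure B] (h : A →[L] B) (R : Set (A × A)) :
    (gen L R).map h = gen L (Prod.map h h '' R) := by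
  apply le_antisymm
  · rw [map_le]
    have key : gen L R ≤ comap h (gen L (Prod.map h h '' R)) :=
      gen_le.2 fun p hp => rel_gen (Set.mem_image_of_mem (Prod.map h h) hp)
    exact key
  · rw [gen_le]
    rintro _ ⟨p, hp, rfl⟩
    exact map_le.1 le_rfl _ _ (rel_gen hp)

theorem Congr.isCompactElement_map {B : Type w'} [L.Structure B] (h : A →[L] B) {θ : Congr L A}
    (hθ : IsCompactElement θ) : IsCompactElement (θ.map h) := by
  obtain ⟨R, hR, rfl⟩ := exists_finite_gen_eq hθ
  rw [map_gen]
  exact isCompactElement_gen (hR.image _)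

theorem Congr.isLUB_gen_union (R S : Set (A × A)) :
    IsLUB {gen L R, gen L S} (gen L (R ∪ S)) := by
  constructor
  · rintro _ (rfl | rfl)
    exacts [gen_mono Set.subset_union_left, gen_mono Set.subset_union_right]
  · intro χ hχ
    rw [gen_le]
    rintro p (hp | hp)
    exacts [gen_le.1 (hχ (by simp)) p hp, gen_le.1 (hχ (by simp)) p hp]

end Congruences

end UnivAlg

namespace UnivAlg

open FirstOrder FirstOrder.Language FirstOrder.Language.Structure

variable {L : FirstOrder.Language.{u, v}}

/-! ### Terms, renaming and consequence -/

section Terms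

/-- Evaluation of terms as a homomorphism. -/
def evalHom [L.IsAlgebraic] {X : Type w} {A : Type w'} [L.Structure A] (f : X → A) :
    L.Term X →[L] A :=
  homOfFun (fun t => t.realize f) fun _ _ => rfl

theorem realize_termStructure [L.IsAlgebraic] {X : Type w} {Y : Type w'} (t : L.Term X)
    (g : X → L.Term Y) : t.realize g = t.subst g := by
  induction t with
  | var => rfl
  | func f ts ih =>
    rw [Term.realize_func]
    exact congrArg (Term.func f) (funext ih)

theorem subst_var {X : Type w} (t : L.Term X) : t.subst Term.var = t := by
  induction t with
  | var => rfl
  | func f ts ih => exact congrArg (Term.func f) (funext ih)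

theorem realize_comp_hom {X : Type*} {A B : Type*} [L.Structure A] [L.Structure B]
    (h : A →[L] B) (f : X → A) (t : L.Term X) :
    t.realize (fun x => h (f x)) = h (t.realize f) :=
  HomClass.realize_term h (v := f) (t := t)

theorem Equation.Holds.map {X : Type*} {A B : Type*} [L.Structure A] [L.Structure B]
    {e : Equation L X} {f : X → A} (he : e.Holds f) (h : A →[L] B) :
    e.Holds (fun x => h (f x)) := by
  unfold Equation.Holds
  rw [realize_comp_hom, realize_comp_hom, he]

theorem Equation.holds_map_iff {X : Type*} {A B : Type*} [L.Structure A] [L.Structure B]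
    {e : Equation L X} {f : X → A} {h : A →[L] B} (hh : Function.Injective h) :
    e.Holds (fun x => h (f x)) ↔ e.Holds f := by
  unfold Equation.Holds
  rw [realize_comp_hom, realize_comp_hom, hh.eq_iff]

theorem holds_rename {X : Type*} {Y : Type*} {A : Type*} [L.Structure A] {g : X → Y}
    {S : Set (Equation L X)} {f : Y → A} :
    (∀ e ∈ rename g S, e.Holds f) ↔ ∀ e ∈ S, e.Holds (f ∘ g) := by
  unfold rename
  rw [Set.forall_mem_image]
  simp only [Equation.Holds, Term.realize_relabel]

theorem rename_rename {X Y Z : Type*} (g : X → Y) (h : Y → Z) (S : Set (Equation L X)) :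
    rename h (rename g S) = rename (h ∘ g) S := by
  unfold rename
  rw [Set.image_image]
  simp only [Term.relabel_relabel]

theorem rename_union {X Y : Type*} (g : X → Y) (S T : Set (Equation L X)) :
    rename g (S ∪ T) = rename g S ∪ rename g T :=
  Set.image_union _ _ _

theorem rename_empty {X Y : Type*} (g : X → Y) :
    rename g (∅ : Set (Equation L X)) = ∅ :=
  Set.image_empty _

theorem finite_rename {X Y : Type*} (g : X → Y) {S : Set (Equation L X)} (hS : S.Finite) :
    (rename g S).Finite :=
  hS.image _

/-- A term involves only finitely many variables. -/
theorem exists_finite_support {X : Type w} (t : L.Term X) :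
    ∃ W : Set X, W.Finite ∧ ∀ {Y : Type w'} (j : Y → X), W ⊆ Set.range j →
      ∃ t₀ : L.Term Y, t₀.relabel j = t := by
  induction t with
  | var x =>
    refine ⟨{x}, Set.finite_singleton x, fun j hj => ?_⟩
    obtain ⟨y, hy⟩ := hj rfl
    exact ⟨Term.var y, congrArg Term.var hy⟩
  | func f ts ih =>
    choose W hW h using ih
    refine ⟨⋃ i, W i, Set.finite_iUnion hW, fun j hj => ?_⟩
    choose t₀ ht₀ using fun i => h i j ((Set.subset_iUnion W i).trans hj)
    exact ⟨Term.func f t₀, congrArg (Term.func f) (funext ht₀)⟩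

/-- A finite set of equations involves only finitely many variables. -/
theorem exists_finite_support_set {X : Type w} {S : Set (Equation L X)} (hS : S.Finite) :
    ∃ W : Set X, W.Finite ∧ ∀ {Y : Type w'} (j : Y → X), W ⊆ Set.range j →
      ∃ S₀ : Set (Equation L Y), S₀.Finite ∧ rename j S₀ = S := by
  choose W hW h using fun t : L.Term X => exists_finite_support.{u, v, w, w'} t
  refine ⟨⋃ e ∈ S, (W e.1 ∪ W e.2), hS.biUnion fun e _ => (hW _).union (hW _), fun j hj => ?_⟩
  have key : ∀ e : S, ∃ e₀ : Equation L _, (e₀.1.relabel j, e₀.2.relabel j) = e.1 := by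
    intro e
    have he := (Set.subset_biUnion_of_mem (u := fun e : Equation L X => W e.1 ∪ W e.2) e.2).trans hj
    obtain ⟨t, ht⟩ := h e.1.1 j (Set.subset_union_left.trans he)
    obtain ⟨s, hs⟩ := h e.1.2 j (Set.subset_union_right.trans he)
    exact ⟨(t, s), Prod.ext ht hs⟩
  choose g hg using key
  have : Finite S := hS
  refine ⟨Set.range g, Set.finite_range g, ?_⟩
  unfold rename
  rw [← Set.range_comp]
  conv_rhs => rw [← Subtype.range_coe (s := S)]
  exact congrArg Set.range (funext hg)

end Terms

namespace Variety

/-! ### Varieties and finitary equational consequence -/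

variable {V : Variety L}

theorem Mem.of_surjective {A : Type w} {B : Type w'} [L.Structure A] [L.Structure B]
    (hA : V.Mem A) (h : A →[L] B) (hh : Function.Surjective h) : V.Mem B := by
  intro e he f
  choose s hs using hh
  have := (hA e he fun n => s (f n)).map h
  simpa only [hs] using this

theorem Mem.quotient [L.IsAlgebraic] {A : Type w} [L.Structure A] (hA : V.Mem A)
    (θ : Congr L A) : V.Mem (Quotient θ.toSetoid) :=
  hA.of_surjective θ.proj θ.proj_surjective

theorem entails_iff {X : Type w} {S D : Set (Equation L X)} :
    V.Entails S D ↔ ∀ e ∈ D, V.Entails S {e} := by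
  constructor
  · intro h e he A _ hA f hf e' he'
    rw [Set.mem_singleton_iff.1 he']
    exact h A hA f hf e he
  · intro h A _ hA f hf e he
    exact h e he A hA f hf e rfl

theorem Entails.of_subset {X : Type w} {S D : Set (Equation L X)} (h : D ⊆ S) :
    V.Entails S D :=
  fun _ _ _ _ hf e he => hf e (h he)

theorem Entails.trans {X : Type w} {S T D : Set (Equation L X)} (h₁ : V.Entails S T)
    (h₂ : V.Entails T D) : V.Entails S D :=
  fun A _ hA f hf => h₂ A hA f (h₁ A hA f hf)

theorem Entails.union {X : Type w} {S D E : Set (Equation L X)} (h₁ : V.Entails S D)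
    (h₂ : V.Entails S E) : V.Entails S (D ∪ E) := by
  rintro A _ hA f hf e (he | he)
  exacts [h₁ A hA f hf e he, h₂ A hA f hf e he]

theorem Entails.mono {X : Type w} {S T D : Set (Equation L X)} (h : V.Entails S D)
    (hST : S ⊆ T) : V.Entails T D :=
  (Entails.of_subset hST).trans h

theorem Entails.rename {X : Type w} {Y : Type w'} {S D : Set (Equation L X)}
    (h : V.Entails S D) (g : X → Y) : V.Entails (rename g S) (rename g D) :=
  fun A _ hA f hf => holds_rename.2 (h A hA (f ∘ g) (holds_rename.1 hf))

/-- An assignment on `X` has to be extended to the variables outside the range of `g`. The constant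
symbol supplies a value for them, even when `X` is empty. -/
theorem entails_rename_iff [Nonempty L.Constants] {X : Type w} {Y : Type w'}
    {S D : Set (Equation L X)} {g : X → Y} (hg : Function.Injective g) :
    V.Entails (UnivAlg.rename g S) (UnivAlg.rename g D) ↔ V.Entails S D := by
  refine ⟨fun h A _ hA f hf => ?_, fun h => h.rename g⟩
  obtain ⟨c⟩ := nonempty_of_nonempty_constants L A
  have key := h A hA (Function.extend g f fun _ => c)
  rw [holds_rename, holds_rename, (Function.extend_comp hg _ _ : _ ∘ g = f)] at key
  exact key hf

variable (V) in
/-- The congruence of consequences of a set of equations. -/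
def theoryCongr [L.IsAlgebraic] {X : Type w} (S : Set (Equation L X)) : Congr L (L.Term X) where
  rel t s := V.Entails S {(t, s)}
  equivalence := by
    refine ⟨fun t A _ _ f _ e he => ?_, fun {t s} h A _ hA f hf e he => ?_,
      fun {t s r} h₁ h₂ A _ hA f hf e he => ?_⟩
    · rw [Set.mem_singleton_iff.1 he]
      rfl
    · rw [Set.mem_singleton_iff.1 he]
      exact (h A hA f hf _ rfl).symm
    · rw [Set.mem_singleton_iff.1 he]
      exact (h₁ A hA f hf _ rfl).trans (h₂ A hA f hf _ rfl)
  compat g x y h A _ hA f hf e he := by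
    rw [Set.mem_singleton_iff.1 he]
    exact congrArg (funMap g) (funext fun i => h i A hA f hf _ rfl)

/-- An assignment in the quotient lifts to a substitution of terms, and substitution instances of
identities are valid in `V`. -/
theorem mem_quotient_term [L.IsAlgebraic] {X : Type w} (θ : Congr L (L.Term X))
    (h : V.validCongr X ≤ θ) : V.Mem (Quotient θ.toSetoid) := by
  intro e he f
  choose g hg using fun n => θ.proj_surjective (f n)
  obtain rfl : (fun n => θ.proj (g n)) = f := funext hg
  unfold Equation.Holds
  rw [realize_comp_hom, realize_comp_hom, θ.proj_eq_iff, realize_termStructure,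
    realize_termStructure]
  refine h _ _ fun A _ hA f' _ e' he' => ?_
  rw [Set.mem_singleton_iff.1 he']
  unfold Equation.Holds
  rw [Term.realize_subst, Term.realize_subst]
  exact hA e he _

theorem realize_proj_var [L.IsAlgebraic] {X : Type w} (θ : Congr L (L.Term X)) (t : L.Term X) :
    t.realize (fun x => θ.proj (Term.var x)) = θ.proj t := by
  rw [realize_comp_hom, realize_termStructure, subst_var]

theorem holds_proj_var [L.IsAlgebraic] {X : Type w} {θ : Congr L (L.Term X)}
    {e : Equation L X} : e.Holds (fun x => θ.proj (Term.var x)) ↔ θ.rel e.1 e.2 := by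
  unfold Equation.Holds
  rw [realize_proj_var, realize_proj_var, θ.proj_eq_iff]

/-- A consequence of a set of equations follows from a finite subset. -/
theorem Entails.exists_finite_single [L.IsAlgebraic] {X : Type} {S : Set (Equation L X)}
    {e : Equation L X} (h : V.Entails S {e}) :
    ∃ S₀ ⊆ S, S₀.Finite ∧ V.Entails S₀ {e} := by
  -- The consequences of finite subsets of `S` form a congruence. Its quotient, with the variables
  -- assigned to their own classes, is an algebra in `V` satisfying `S`, hence satisfying `e`.
  let θ : Congr L (L.Term X) := Congr.directedUnion
    (V.theoryCongr '' {S₀ | S₀ ⊆ S ∧ S₀.Finite}) ⟨_, ∅, by simp, rfl⟩ (by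
      rintro _ ⟨S₀, h₀, rfl⟩ _ ⟨S₁, h₁, rfl⟩
      exact ⟨_, ⟨S₀ ∪ S₁, ⟨Set.union_subset h₀.1 h₁.1, h₀.2.union h₁.2⟩, rfl⟩,
        fun _ _ hab => Entails.mono hab Set.subset_union_left,
        fun _ _ hab => Entails.mono hab Set.subset_union_right⟩)
  have hθ : V.Mem (Quotient θ.toSetoid) :=
    mem_quotient_term θ fun a b hab => ⟨_, ⟨∅, by simp, rfl⟩, hab⟩
  obtain ⟨_, ⟨S₀, h₀, rfl⟩, he⟩ := holds_proj_var.1 (h _ hθ (fun x => θ.proj (Term.var x))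
    (fun e' he' => holds_proj_var.2 ⟨_, ⟨{e'}, by simpa using he', rfl⟩,
      Entails.of_subset (V := V) (Set.singleton_subset_iff.2 rfl)⟩) e rfl)
  exact ⟨S₀, h₀.1, h₀.2, he⟩

theorem Entails.exists_finite [L.IsAlgebraic] {X : Type} {S D : Set (Equation L X)}
    (hD : D.Finite) (h : V.Entails S D) : ∃ S₀ ⊆ S, S₀.Finite ∧ V.Entails S₀ D := by
  choose! T hTS hT hTe using fun e (he : e ∈ D) => (entails_iff.1 h e he).exists_finite_single
  exact ⟨⋃ e ∈ D, T e, Set.iUnion₂_subset hTS, hD.biUnion hT,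
    entails_iff.2 fun e he => (hTe e he).mono (Set.subset_biUnion_of_mem he)⟩

/-! ### Presentations -/

variable (V) in
/-- The algebra `A` is presented by the generators `a` and the relations `S`. -/
structure IsPres {X : Type} {A : Type u} [L.Structure A] (a : X → A)
    (S : Set (Equation L X)) : Prop where
  mem : V.Mem A
  surj : ∀ y : A, ∃ t : L.Term X, t.realize a = y
  holds_iff : ∀ e : Equation L X, e.Holds a ↔ V.Entails S {e}

variable (V) in
/-- The algebra presented by a set of equations. -/
abbrev Presented [L.IsAlgebraic] {X : Type} (S : Set (Equation L X)) : Type u :=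
  Quotient (V.theoryCongr S).toSetoid

variable (V) in
theorem isPres_presented [L.IsAlgebraic] {X : Type} (S : Set (Equation L X)) :
    V.IsPres (A := V.Presented S) (fun x => (V.theoryCongr S).proj (Term.var x)) S where
  mem := mem_quotient_term _ fun _ _ h => Entails.mono h (Set.empty_subset S)
  surj y := by
    obtain ⟨t, rfl⟩ := (V.theoryCongr S).proj_surjective y
    exact ⟨t, realize_proj_var _ t⟩
  holds_iff _ := holds_proj_var

variable (V) in
theorem isPres_freeAlgebra [L.IsAlgebraic] (X : Type) :
    V.IsPres (A := V.FreeAlgebra X) (fun x => (V.validCongr X).proj (Term.var x)) ∅ :=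
  V.isPres_presented ∅

namespace IsPres

variable {X : Type} {A : Type u} [L.Structure A] {a : X → A} {S : Set (Equation L X)}

theorem holds (h : V.IsPres a S) : ∀ e ∈ S, e.Holds a :=
  fun e he => (h.holds_iff e).2 (Entails.of_subset (by simpa using he))

theorem realize_eq_iff (h : V.IsPres a S) {t s : L.Term X} :
    t.realize a = s.realize a ↔ V.Entails S {(t, s)} :=
  h.holds_iff (t, s)

theorem exists_hom [L.IsAlgebraic] (h : V.IsPres a S) {B : Type u} [L.Structure B]
    (hB : V.Mem B) {f : X → B} (hf : ∀ e ∈ S, e.Holds f) : ∃ g : A →[L] B, ∀ x, g (a x) = f x := by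
  obtain ⟨g, hg⟩ := exists_factor (evalHom a) h.surj (evalHom f) fun t s hts =>
    h.realize_eq_iff.1 hts B hB f hf _ rfl
  exact ⟨g, fun x => hg (Term.var x)⟩

theorem hom_ext (h : V.IsPres a S) {B : Type w} [L.Structure B] {g g' : A →[L] B}
    (hg : ∀ x, g (a x) = g' (a x)) : g = g' := by
  ext y
  obtain ⟨t, rfl⟩ := h.surj y
  rw [← realize_comp_hom, ← realize_comp_hom, funext hg]

/-- The pairs of elements described by a set of equations. -/
def _root_.UnivAlg.pairs {X : Type*} {A : Type*} [L.Structure A] (a : X → A)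
    (R : Set (Equation L X)) : Set (A × A) :=
  (fun e => (e.1.realize a, e.2.realize a)) '' R

theorem quotient [L.IsAlgebraic] (h : V.IsPres a S) (R : Set (Equation L X)) :
    V.IsPres (fun x => (Congr.gen L (pairs a R)).proj (a x)) (S ∪ R) where
  mem := h.mem.quotient _
  surj y := by
    obtain ⟨y, rfl⟩ := Congr.proj_surjective _ y
    obtain ⟨t, rfl⟩ := h.surj y
    exact ⟨t, realize_comp_hom _ _ _⟩
  holds_iff e := by
    constructor
    · intro he
      unfold Equation.Holds at he
      rw [realize_comp_hom, realize_comp_hom, Congr.proj_eq_iff] at he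
      intro B _ hB f hf e' he'
      rw [Set.mem_singleton_iff.1 he']
      obtain ⟨g, hg⟩ := h.exists_hom hB fun e he => hf e (Or.inl he)
      obtain rfl : (fun x => g (a x)) = f := funext hg
      unfold Equation.Holds
      rw [realize_comp_hom, realize_comp_hom]
      -- An assignment satisfying `S` and `R` induces a homomorphism whose kernel contains the
      -- generating pairs, hence the whole generated congruence.
      refine he (Congr.ker g) ?_
      rintro _ ⟨e, he, rfl⟩
      have := hf e (Or.inr he)
      unfold Equation.Holds at this
      rwa [realize_comp_hom, realize_comp_hom] at this
    · intro he
      refine he _ (h.mem.quotient _) _ ?_ e rfl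
      rintro e' (he' | he')
      · exact (h.holds e' he').map _
      · unfold Equation.Holds
        rw [realize_comp_hom, realize_comp_hom, Congr.proj_eq_iff]
        exact Congr.rel_gen (Set.mem_image_of_mem _ he')

theorem gen_rel_iff [L.IsAlgebraic] (h : V.IsPres a S) {R : Set (Equation L X)}
    {t s : L.Term X} :
    (Congr.gen L (pairs a R)).rel (t.realize a) (s.realize a) ↔ V.Entails (S ∪ R) {(t, s)} := by
  rw [← (h.quotient R).realize_eq_iff, realize_comp_hom, realize_comp_hom, Congr.proj_eq_iff]

/-- The dictionary between inclusion of congruences and consequence, used whenever an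
order-theoretic condition is turned into interpolation. -/
theorem gen_le_gen_iff [L.IsAlgebraic] (h : V.IsPres a S) {R T : Set (Equation L X)} :
    Congr.gen L (pairs a R) ≤ Congr.gen L (pairs a T) ↔ V.Entails (S ∪ T) R := by
  rw [Congr.gen_le, entails_iff]
  unfold pairs
  rw [Set.forall_mem_image]
  exact forall₂_congr fun e _ => h.gen_rel_iff

/-- A compact congruence on a presented algebra is generated by finitely many equations. -/
theorem exists_gen_eq (h : V.IsPres a S) {θ : Congr L A} (hθ : IsCompactElement θ) :
    ∃ R : Set (Equation L X), R.Finite ∧ Congr.gen L (pairs a R) = θ := by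
  obtain ⟨R, hR, rfl⟩ := Congr.exists_finite_gen_eq hθ
  choose t ht using h.surj
  refine ⟨(fun p => (t p.1, t p.2)) '' R, hR.image _, ?_⟩
  unfold pairs
  rw [Set.image_image]
  simp only [ht, Prod.mk.eta, Set.image_id']

/-- A presentation can be extended by further generators. -/
theorem extend [L.IsAlgebraic] (h : V.IsPres a S) (hS : S.Finite) {W : Type} [Finite W]
    (i : X → W) (d : W → A) (hd : ∀ x, d (i x) = a x) :
    ∃ T : Set (Equation L W), T.Finite ∧ V.IsPres d T := by
  choose t ht using fun w => h.surj (d w)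
  have hda : d ∘ i = a := funext hd
  -- Besides the old relations, one equation per new generator `w` identifies it with a term `t w`
  -- in the old generators.
  refine ⟨rename i S ∪ Set.range fun w => (Term.var w, (t w).relabel i),
    (finite_rename i hS).union (Set.finite_range _), h.mem, fun y => ?_, fun e => ⟨?_, ?_⟩⟩
  · obtain ⟨s, rfl⟩ := h.surj y
    exact ⟨s.relabel i, by rw [Term.realize_relabel, hda]⟩
  · intro he B _ hB f hf e' he'
    rw [Set.mem_singleton_iff.1 he']
    obtain ⟨g, hg⟩ := h.exists_hom hB (holds_rename.1 fun e he => hf e (Or.inl he))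
    have hgf : (fun w => g (d w)) = f := funext fun w => by
      have hw : f w = ((t w).relabel i).realize f := hf _ (Or.inr ⟨w, rfl⟩)
      rw [hw, Term.realize_relabel, ← ht w, ← realize_comp_hom, funext hg]
    rw [← hgf]
    exact he.map g
  · intro he
    refine he A h.mem d ?_ e rfl
    rintro e' (he' | ⟨w, rfl⟩)
    · exact holds_rename.2 (hda.symm ▸ h.holds) e' he'
    · unfold Equation.Holds
      rw [Term.realize_relabel, hda, ht]
      rfl

theorem finitelyPresented [L.IsAlgebraic] [Finite X] (h : V.IsPres a S) (hS : S.Finite) :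
    V.FinitelyPresented A := by
  have hF := V.isPres_freeAlgebra X
  obtain ⟨p, hp⟩ := hF.exists_hom h.mem (f := a) (by simp)
  refine ⟨X, inferInstance, p, fun y => ?_, ?_⟩
  · obtain ⟨t, rfl⟩ := h.surj y
    exact ⟨_, (realize_comp_hom p _ t).symm.trans (congrArg (fun f => t.realize f) (funext hp))⟩
  · have : Congr.ker p = Congr.gen L (pairs (fun x => (V.validCongr X).proj (Term.var x)) S) := by
      ext y z
      obtain ⟨t, rfl⟩ := hF.surj y
      obtain ⟨s, rfl⟩ := hF.surj z
      rw [hF.gen_rel_iff, Set.empty_union, ← h.realize_eq_iff, ← funext hp, realize_comp_hom p,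
        realize_comp_hom p]
      rfl
    have hc : IsCompactElement (Congr.ker p) := this ▸ Congr.isCompactElement_gen (hS.image _)
    exact hc

end IsPres

theorem FinitelyPresented.exists_isPres [L.IsAlgebraic] {A : Type u} [L.Structure A]
    (hA : V.Mem A) (h : V.FinitelyPresented A) :
    ∃ (X : Type) (_ : Finite X) (a : X → A) (S : Set (Equation L X)),
      S.Finite ∧ V.IsPres a S := by
  obtain ⟨X, hX, p, hp, hker⟩ := h
  have hF := V.isPres_freeAlgebra X
  obtain ⟨R, hR, hRp⟩ := hF.exists_gen_eq hker
  refine ⟨X, hX, fun x => p ((V.validCongr X).proj (Term.var x)), R, hR, hA, fun y => ?_,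
    fun e => ?_⟩
  · obtain ⟨y, rfl⟩ := hp y
    obtain ⟨t, rfl⟩ := hF.surj y
    exact ⟨t, realize_comp_hom p _ t⟩
  · unfold Equation.Holds
    rw [realize_comp_hom p, realize_comp_hom p, ← Set.empty_union R, ← hF.gen_rel_iff, hRp]
    rfl

end Variety

end UnivAlg

namespace UnivAlg

open FirstOrder FirstOrder.Language FirstOrder.Language.Structure

/-! ### Dually Heyting ordered sets -/

section Order

variable {P : Type w} [PartialOrder P]

theorem IsDualHeyting.hasFiniteMeets (h : IsDualHeyting P) : HasFiniteMeets P := by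
  obtain ⟨H, hH⟩ := h
  intro s hs
  induction s, hs using Set.Finite.induction_on with
  | empty =>
    exact ⟨OrderDual.ofDual H.bot, by simp, fun x _ => (hH _ (OrderDual.toDual x)).1 (H.bot_le _)⟩
  | insert _ _ ih =>
    obtain ⟨m, hm⟩ := ih
    rename_i a s _ _
    refine ⟨OrderDual.ofDual (H.sup (OrderDual.toDual a) (OrderDual.toDual m)), ?_, ?_⟩
    · rintro x (rfl | hx)
      · exact (hH _ _).1 (H.le_sup_left (OrderDual.toDual x) (OrderDual.toDual m))
      · exact le_trans ((hH _ _).1 (H.le_sup_right (OrderDual.toDual a) (OrderDual.toDual m)))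
          (hm.1 hx)
    · intro x hx
      refine (hH _ (OrderDual.toDual x)).1 (H.sup_le _ _ _ ?_ ?_)
      · exact (hH _ _).2 (hx (Set.mem_insert a s))
      · exact (hH _ _).2 (hm.2 fun y hy => hx (Set.mem_insert_of_mem a hy))

/-- The element `d` is the difference of `a` and `b`, the implication of the order dual. Joins enter
only through `IsLUB`, so the property does not depend on a chosen lattice structure. -/
theorem IsDualHeyting.exists_sdiff (h : IsDualHeyting P) (a b : P) :
    ∃ d : P, ∀ c j, IsLUB {b, c} j → (d ≤ c ↔ a ≤ j) := by
  obtain ⟨H, hH⟩ := h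
  refine ⟨OrderDual.ofDual (H.himp (OrderDual.toDual b) (OrderDual.toDual a)), fun c j hj => ?_⟩
  have hinf : j = OrderDual.ofDual (H.inf (OrderDual.toDual c) (OrderDual.toDual b)) := by
    apply le_antisymm
    · apply hj.2
      rintro x (rfl | rfl)
      · exact (hH _ (OrderDual.toDual x)).1 (H.inf_le_right _ _)
      · exact (hH _ (OrderDual.toDual x)).1 (H.inf_le_left _ _)
    · exact (hH (OrderDual.toDual j) _).1
        (H.le_inf _ _ _ ((hH _ _).2 (hj.1 (Set.mem_insert_of_mem _ rfl)))
          ((hH _ _).2 (hj.1 (Set.mem_insert _ _))))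
  rw [hinf]
  exact (hH (OrderDual.toDual c) _).symm.trans ((H.le_himp_iff _ _ _).trans (hH _ _))

theorem isDualHeyting_of_exists_sdiff (hm : HasFiniteMeets P) (hbot : ∃ b : P, ∀ a, b ≤ a)
    (hj : ∀ a b : P, ∃ j, IsLUB {a, b} j)
    (hs : ∀ a b : P, ∃ d : P, ∀ c j, IsLUB {b, c} j → (d ≤ c ↔ a ≤ j)) : IsDualHeyting P := by
  obtain ⟨bot, hbot⟩ := hbot
  obtain ⟨top, htop⟩ := hm ∅ Set.finite_empty
  choose sup hsup using hj
  choose inf hinf using fun a b : P => hm {a, b} (by simp)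
  choose sdiff hsdiff using hs
  exact ⟨{
    (inferInstance : PartialOrder Pᵒᵈ) with
    sup := fun a b => OrderDual.toDual (inf a.ofDual b.ofDual)
    le_sup_left := fun a b => (hinf a.ofDual b.ofDual).1 (Set.mem_insert _ _)
    le_sup_right := fun a b => (hinf a.ofDual b.ofDual).1 (Set.mem_insert_of_mem _ rfl)
    sup_le := fun a b c h₁ h₂ => (hinf a.ofDual b.ofDual).2 (by
      rintro _ (rfl | rfl)
      exacts [h₁, h₂])
    inf := fun a b => OrderDual.toDual (sup a.ofDual b.ofDual)
    inf_le_left := fun a b => (hsup a.ofDual b.ofDual).1 (Set.mem_insert _ _)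
    inf_le_right := fun a b => (hsup a.ofDual b.ofDual).1 (Set.mem_insert_of_mem _ rfl)
    le_inf := fun c a b h₁ h₂ => (hsup a.ofDual b.ofDual).2 (by
      rintro _ (rfl | rfl)
      exacts [h₁, h₂])
    top := OrderDual.toDual bot
    le_top := fun a => hbot a.ofDual
    bot := OrderDual.toDual top
    bot_le := fun a => htop.2 fun _ h => h.elim
    himp := fun b a => OrderDual.toDual (sdiff a.ofDual b.ofDual)
    le_himp_iff := fun c b a => hsdiff a.ofDual b.ofDual c.ofDual (sup c.ofDual b.ofDual) (by
      rw [Set.pair_comm]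
      exact hsup _ _)
    compl := fun b => OrderDual.toDual (sdiff top b.ofDual)
    himp_bot := fun _ => rfl }, fun _ _ => Iff.rfl⟩

end Order

/-! ### Compact congruences and finite presentations -/

variable {L : FirstOrder.Language.{u, v}}

/-- The compact congruence generated by a finite set of pairs. -/
def KCon.gen {A : Type w} [L.Structure A] (R : Set (A × A)) (hR : R.Finite) : KCon L A :=
  ⟨Congr.gen L R, Congr.isCompactElement_gen hR⟩

theorem KCon.isLUB_gen_union {A : Type w} [L.Structure A] {R T : Set (A × A)} (hR : R.Finite)
    (hT : T.Finite) :
    IsLUB {KCon.gen (L := L) R hR, KCon.gen T hT} (KCon.gen (R ∪ T) (hR.union hT)) := by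
  have h := Congr.isLUB_gen_union (L := L) R T
  constructor
  · rintro _ (rfl | rfl)
    exacts [h.1 (Set.mem_insert _ _), h.1 (Set.mem_insert_of_mem _ rfl)]
  · intro χ hχ
    refine h.2 ?_
    rintro _ (rfl | rfl)
    exacts [hχ (Set.mem_insert _ _), hχ (Set.mem_insert_of_mem _ rfl)]

theorem pairs_union {X A : Type*} [L.Structure A] (a : X → A) (R T : Set (Equation L X)) :
    pairs a (R ∪ T) = pairs a R ∪ pairs a T :=
  Set.image_union _ _ _

theorem finite_pairs {X A : Type*} [L.Structure A] (a : X → A) {R : Set (Equation L X)}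
    (hR : R.Finite) : (pairs a R).Finite :=
  hR.image _

namespace Variety

variable {V : Variety L}

theorem _root_.UnivAlg.FPAlg.exists_isPres [L.IsAlgebraic] (A : FPAlg V) :
    ∃ (X : Type) (_ : Finite X) (a : X → A.carrier) (S : Set (Equation L X)),
      S.Finite ∧ V.IsPres a S :=
  A.finitelyPresented.exists_isPres A.mem

/-- The presented algebra as a finitely presented algebra. -/
def presentedFPAlg [L.IsAlgebraic] (V : Variety L) {X : Type} [Finite X] (S : Set (Equation L X))
    (hS : S.Finite) : FPAlg V where
  carrier := V.Presented S
  mem := (V.isPres_presented S).mem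
  finitelyPresented := (V.isPres_presented S).finitelyPresented hS

theorem exists_fpAlg_isPres [L.IsAlgebraic] (V : Variety L) {X : Type} [Finite X]
    {S : Set (Equation L X)} (hS : S.Finite) :
    ∃ (A : FPAlg V) (a : X → A.carrier), V.IsPres a S :=
  ⟨V.presentedFPAlg S hS, _, V.isPres_presented S⟩

/-! ### Deductive and Maehara interpolation -/

/-- `P` is a right uniform interpolant of `G` also in the presence of side equations. -/
def IsRightInterpolant (V : Variety L) {X Y : Type} (G : Set (Equation L (X ⊕ Y)))
    (P : Set (Equation L Y)) : Prop :=
  ∀ (Z : Type) (S D : Set (Equation L (Y ⊕ Z))), S.Finite → D.Finite →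
    (V.Entails (X := X ⊕ (Y ⊕ Z))
        (UnivAlg.rename (Sum.map id Sum.inl) G ∪ UnivAlg.rename Sum.inr S)
        (UnivAlg.rename Sum.inr D) ↔
      V.Entails (UnivAlg.rename Sum.inl P ∪ S) D)

theorem map_comp_inl {X Y X' Y' : Type*} (f : X → X') (g : Y → Y') :
    Sum.map f g ∘ Sum.inl = Sum.inl ∘ f := rfl

theorem map_comp_inr {X Y X' Y' : Type*} (f : X → X') (g : Y → Y') :
    Sum.map f g ∘ Sum.inr = Sum.inr ∘ g := rfl

theorem map_inj {X Y X' Y' : Type*} {f : X → X'} {g : Y → Y'} (hf : Function.Injective f)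
    (hg : Function.Injective g) : Function.Injective (Sum.map f g) :=
  Sum.map_injective.2 ⟨hf, hg⟩


/-- The instance with no side equations and no side variables. -/
theorem IsRightInterpolant.entails_iff [Nonempty L.Constants] {X Y : Type} {G : Set (Equation L (X ⊕ Y))}
    {P : Set (Equation L Y)} (h : V.IsRightInterpolant G P) {D : Set (Equation L Y)}
    (hD : D.Finite) : V.Entails G (UnivAlg.rename Sum.inr D) ↔ V.Entails P D := by
  have key := h Empty ∅ (UnivAlg.rename Sum.inl D) Set.finite_empty (finite_rename _ hD)
  rw [rename_empty, Set.union_empty, Set.union_empty, entails_rename_iff Sum.inl_injective,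
    rename_rename, show (Sum.inr ∘ Sum.inl : Y → X ⊕ (Y ⊕ Empty)) =
      Sum.map id Sum.inl ∘ Sum.inr from rfl, ← rename_rename,
    entails_rename_iff (map_inj Function.injective_id Sum.inl_injective)] at key
  exact key

theorem RightUniformMaehara.rightUniformDeductive [Nonempty L.Constants] (h : V.RightUniformMaehara) :
    V.RightUniformDeductive := by
  intro X Y _ _ S hS
  obtain ⟨P, hP, hSP⟩ := h X Y S hS
  have hSP' : V.IsRightInterpolant S P := hSP
  refine ⟨P, hP, (hSP'.entails_iff hP).2 (Entails.of_subset subset_rfl), fun Z e he => ?_⟩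
  have key := hSP Z ∅ {e} Set.finite_empty (Set.finite_singleton e)
  rw [rename_empty, Set.union_empty, Set.union_empty] at key
  exact key.1 he

theorem LeftUniformMaehara.leftUniformDeductive [Nonempty L.Constants] [L.IsAlgebraic] (h : V.LeftUniformMaehara) :
    V.LeftUniformDeductive := by
  intro Y Z _ _ D hD
  obtain ⟨P, hP, hDP⟩ := h Y Z ∅ D Set.finite_empty hD
  simp only [rename_empty, Set.union_empty] at hDP
  refine ⟨P, hP, ?_, fun X S hS => ?_⟩
  -- With no variables eliminated and `Γ` equal to `P` itself, the trivial `P ⊨ P` yields `P ⊨ D`.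
  · have key := (hDP Empty (UnivAlg.rename Sum.inr P) (finite_rename _ hP)).2
      (Entails.of_subset subset_rfl)
    rwa [rename_rename, show (Sum.map id Sum.inl ∘ Sum.inr : Y → Empty ⊕ (Y ⊕ Z)) =
      Sum.inr ∘ Sum.inl from rfl, ← rename_rename, entails_rename_iff Sum.inr_injective] at key
  -- The deductive property allows infinitely many premises and the Maehara property only finitely
  -- many; compactness of consequence bridges the gap.
  · obtain ⟨T, hTS, hT, hTD⟩ := hS.exists_finite (finite_rename _ hD)
    obtain ⟨T₀, hT₀S, hT₀, hTD⟩ := Set.exists_subset_image_finite_and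
      (p := fun T => V.Entails T (UnivAlg.rename Sum.inr D)).1 ⟨T, hTS, hT, hTD⟩
    exact ((hDP X T₀ hT₀).1 hTD).mono hT₀S

theorem LeftUniformMaehara.isDualHeyting [Nonempty L.Constants] [L.IsAlgebraic] (h : V.LeftUniformMaehara) (A : FPAlg V)
    (hm : HasFiniteMeets (KCon L A.carrier)) : IsDualHeyting (KCon L A.carrier) := by
  obtain ⟨Y, _, a, R, hR, ha⟩ := FPAlg.exists_isPres A
  have hgen : ∀ θ : KCon L A.carrier, ∃ (T : Set (Equation L Y)) (hT : T.Finite),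
      KCon.gen (pairs a T) (finite_pairs a hT) = θ := fun θ => by
    obtain ⟨T, hT, hTθ⟩ := ha.exists_gen_eq θ.2
    exact ⟨T, hT, Subtype.ext hTθ⟩
  refine isDualHeyting_of_exists_sdiff hm ⟨KCon.gen ∅ Set.finite_empty, fun θ => ?_⟩
    (fun θ ψ => ?_) fun θ ψ => ?_
  · have : Congr.gen L ∅ ≤ θ.1 := Congr.gen_le.2 (by simp)
    exact this
  · obtain ⟨T, hT, rfl⟩ := hgen θ
    obtain ⟨U, hU, rfl⟩ := hgen ψ
    exact ⟨_, KCon.isLUB_gen_union _ _⟩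
  · obtain ⟨T, hT, rfl⟩ := hgen θ
    obtain ⟨U, hU, rfl⟩ := hgen ψ
    -- The difference of `T` and `U` in the algebra with relations `R`: the side equations are `R ∪
    -- U`, and the premises `Γ` will be `R ∪ G` for each competing congruence `G`.
    obtain ⟨P, hP, hP'⟩ := h Y Empty (UnivAlg.rename Sum.inl (R ∪ U)) (UnivAlg.rename Sum.inl T)
      (finite_rename _ (hR.union hU)) (finite_rename _ hT)
    refine ⟨KCon.gen (pairs a P) (finite_pairs a hP), fun c j hj => ?_⟩
    obtain ⟨G, hG, rfl⟩ := hgen c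
    obtain rfl := hj.unique (KCon.isLUB_gen_union (finite_pairs a hU) (finite_pairs a hG))
    have key := hP' Empty (UnivAlg.rename Sum.inr (R ∪ G)) (finite_rename _ (hR.union hG))
    rw [entails_rename_iff Sum.inr_injective, rename_rename, rename_rename, rename_rename,
      show (Sum.map id Sum.inl ∘ Sum.inr : Y → Empty ⊕ (Y ⊕ Empty)) = Sum.inr ∘ Sum.inl from rfl,
      ← rename_union, entails_rename_iff (Sum.inr_injective.comp Sum.inl_injective)] at key
    change Congr.gen L (pairs a P) ≤ Congr.gen L (pairs a G) ↔
      Congr.gen L (pairs a T) ≤ Congr.gen L (pairs a U ∪ pairs a G)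
    rw [← pairs_union, ha.gen_le_gen_iff, ha.gen_le_gen_iff, ← key]
    rw [show R ∪ G ∪ (R ∪ U) = R ∪ (U ∪ G) by
      ext; simp only [Set.mem_union]; tauto]

/-- The easy half of right Maehara interpolation: it needs only that `P` follows from `G`. -/
theorem Entails.union_rename {X Y Z : Type} {G : Set (Equation L (X ⊕ Y))}
    {P : Set (Equation L Y)} (hGP : V.Entails G (UnivAlg.rename Sum.inr P))
    {S D : Set (Equation L (Y ⊕ Z))} (hD : V.Entails (UnivAlg.rename Sum.inl P ∪ S) D) :
    V.Entails (X := X ⊕ (Y ⊕ Z))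
      (UnivAlg.rename (Sum.map id Sum.inl) G ∪ UnivAlg.rename Sum.inr S)
      (UnivAlg.rename Sum.inr D) := by
  have h₁ := hGP.rename (Sum.map id Sum.inl : X ⊕ Y → X ⊕ (Y ⊕ Z))
  rw [rename_rename, show (Sum.map id Sum.inl ∘ Sum.inr : Y → X ⊕ (Y ⊕ Z)) =
    Sum.inr ∘ Sum.inl from rfl, ← rename_rename] at h₁
  have h₂ := hD.rename (Sum.inr : Y ⊕ Z → X ⊕ (Y ⊕ Z))
  rw [rename_union] at h₂
  exact ((h₁.mono Set.subset_union_left).union (Entails.of_subset Set.subset_union_right)).trans h₂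

/-- With the congruence extension property, side equations in the common variables and the
interpolant variables may be added to right uniform deductive interpolation. -/
theorem RightUniformDeductive.rightUniformMaehara [L.IsAlgebraic] (h : V.RightUniformDeductive)
    (hCEP : V.CongruenceExtension) : V.RightUniformMaehara := by
  intro X Y _ _ G hG
  obtain ⟨P, hP, hGP, hP'⟩ := h X Y G hG
  refine ⟨P, hP, fun Z S D hS hD => ⟨fun hD' => ?_, fun hD' => ?_⟩⟩
  · intro C _ hC f hf
    let G' : Set (Equation L (X ⊕ (Y ⊕ Z))) := UnivAlg.rename (Sum.map id Sum.inl) G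
    have hB := V.isPres_presented G'
    let b : X ⊕ (Y ⊕ Z) → V.Presented G' := fun x => (V.theoryCongr G').proj (Term.var x)
    let q : L.Term (Y ⊕ Z) →[L] V.Presented G' := evalHom (b ∘ Sum.inr)
    -- The subalgebra generated by the variables in `Y ⊕ Z`. Right deductive interpolation says that
    -- every equation valid for these generators follows from `P`, so `f` induces a homomorphism `r`
    -- from `B₀` to `C`.
    let B₀ : L.Substructure (V.Presented G') := q.range
    let q₀ : L.Term (Y ⊕ Z) →[L] B₀ := homOfFun (fun t => ⟨q t, t, rfl⟩) fun g x =>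
      Subtype.ext (q.map_fun g x)
    have hq₀ : Function.Surjective q₀ := by
      rintro ⟨_, t, rfl⟩
      exact ⟨t, rfl⟩
    have hker : ∀ t s, q₀ t = q₀ s → evalHom f t = evalHom f s := by
      intro t s hts
      have hts : t.realize (b ∘ Sum.inr) = s.realize (b ∘ Sum.inr) := congrArg Subtype.val hts
      rw [← Term.realize_relabel, ← Term.realize_relabel] at hts
      have : V.Entails G' (UnivAlg.rename Sum.inr {(t, s)}) := by
        unfold UnivAlg.rename
        rw [Set.image_singleton]
        exact hB.realize_eq_iff.1 hts
      exact hP' Z (t, s) this C hC f (fun e he => hf e (Or.inl he)) _ rfl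
    obtain ⟨r, hr⟩ := exists_factor q₀ hq₀ (evalHom f) hker
    -- Extending the kernel of `r` to the whole algebra gives a quotient that still satisfies `G`,
    -- and in which an equation over `Y ⊕ Z` holds exactly when it holds in `C` under `f`.
    obtain ⟨ψ, hψ⟩ := hCEP _ hB.mem B₀ (Congr.ker r)
    have hψ' : ∀ e : Equation L (Y ⊕ Z),
        e.Holds ((fun x => ψ.proj (b x)) ∘ Sum.inr) ↔ e.Holds f := by
      intro e
      have key := hψ (q₀ e.1) (q₀ e.2)
      change r (q₀ e.1) = r (q₀ e.2) ↔ ψ.rel (q e.1) (q e.2) at key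
      rw [hr, hr, ← Congr.proj_eq_iff] at key
      unfold Equation.Holds
      rw [show (fun x => ψ.proj (b x)) ∘ Sum.inr = fun x => ψ.proj ((b ∘ Sum.inr) x) from rfl,
        realize_comp_hom, realize_comp_hom]
      exact key.symm
    have hD'' := hD' _ (hB.mem.quotient ψ) (fun x => ψ.proj (b x)) (by
      rintro e (he | he)
      · exact (hB.holds e he).map ψ.proj
      · revert e
        rw [holds_rename]
        exact fun e he => (hψ' e).2 (hf e (Or.inr he)))
    rw [holds_rename] at hD''
    exact fun e he => (hψ' e).1 (hD'' e he)
  · exact hGP.union_rename hD'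

/-- Left uniform Maehara interpolation may be tested with finitely many eliminated variables. -/
theorem leftUniformMaehara_of_finite [Nonempty L.Constants]
    (h : ∀ (Y Z : Type) [Finite Y] [Finite Z] (S D : Set (Equation L (Y ⊕ Z))),
      S.Finite → D.Finite → ∃ P : Set (Equation L Y), P.Finite ∧
        ∀ (X : Type) [Finite X] (G : Set (Equation L (X ⊕ Y))), G.Finite →
          (V.Entails (X := X ⊕ (Y ⊕ Z))
              (UnivAlg.rename (Sum.map id Sum.inl) G ∪ UnivAlg.rename Sum.inr S)
              (UnivAlg.rename Sum.inr D) ↔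
            V.Entails G (UnivAlg.rename Sum.inr P))) : V.LeftUniformMaehara := by
  intro Y Z _ _ S D hS hD
  obtain ⟨P, hP, hP'⟩ := h Y Z S D hS hD
  refine ⟨P, hP, fun X G hG => ?_⟩
  obtain ⟨W, hW, hGW⟩ := exists_finite_support_set.{u, v, 0, 0} hG
  -- Only the variables of `X` occurring in `G` matter.
  let X₀ := {x : X // Sum.inl x ∈ W}
  have : Finite X₀ := hW.preimage Sum.inl_injective.injOn
  obtain ⟨G, hG₀, rfl⟩ := hGW (Sum.map Subtype.val id : X₀ ⊕ Y → X ⊕ Y) (by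
    rintro (x | y) hx
    exacts [⟨Sum.inl ⟨x, hx⟩, rfl⟩, ⟨Sum.inr y, rfl⟩])
  have key := hP' X₀ G hG₀
  rw [← entails_rename_iff (map_inj Subtype.val_injective Function.injective_id :
      Function.Injective (Sum.map Subtype.val id : X₀ ⊕ (Y ⊕ Z) → X ⊕ (Y ⊕ Z))),
    ← entails_rename_iff (map_inj Subtype.val_injective Function.injective_id :
      Function.Injective (Sum.map Subtype.val id : X₀ ⊕ Y → X ⊕ Y)),
    rename_union, rename_rename, rename_rename, rename_rename, rename_rename] at key
  simp only [rename_rename, Sum.map_comp_map, map_comp_inr, CompTriple.comp_eq] at key ⊢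
  exact key

/-- Right uniform Maehara interpolation may be tested with finitely many side variables. -/
theorem rightUniformMaehara_of_finite [Nonempty L.Constants]
    (h : ∀ (X Y : Type) [Finite X] [Finite Y] (G : Set (Equation L (X ⊕ Y))), G.Finite →
      ∃ P : Set (Equation L Y), P.Finite ∧
        ∀ (Z : Type) [Finite Z] (S D : Set (Equation L (Y ⊕ Z))), S.Finite → D.Finite →
          (V.Entails (X := X ⊕ (Y ⊕ Z))
              (UnivAlg.rename (Sum.map id Sum.inl) G ∪ UnivAlg.rename Sum.inr S)
              (UnivAlg.rename Sum.inr D) ↔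
            V.Entails (UnivAlg.rename Sum.inl P ∪ S) D)) : V.RightUniformMaehara := by
  intro X Y _ _ G hG
  obtain ⟨P, hP, hP'⟩ := h X Y G hG
  refine ⟨P, hP, fun Z S D hS hD => ?_⟩
  obtain ⟨W, hW, hSW⟩ := exists_finite_support_set.{u, v, 0, 0} hS
  obtain ⟨W', hW', hDW⟩ := exists_finite_support_set.{u, v, 0, 0} hD
  let Z₀ := {z : Z // Sum.inr z ∈ W ∪ W'}
  have : Finite Z₀ := (hW.union hW').preimage Sum.inr_injective.injOn
  have hrange : W ∪ W' ⊆ Set.range (Sum.map id Subtype.val : Y ⊕ Z₀ → Y ⊕ Z) := by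
    rintro (y | z) hz
    exacts [⟨Sum.inl y, rfl⟩, ⟨Sum.inr ⟨z, hz⟩, rfl⟩]
  obtain ⟨S, hS₀, rfl⟩ := hSW _ (Set.subset_union_left.trans hrange)
  obtain ⟨D, hD₀, rfl⟩ := hDW _ (Set.subset_union_right.trans hrange)
  have hinj := (map_inj Function.injective_id Subtype.val_injective :
      Function.Injective (Sum.map id Subtype.val : Y ⊕ Z₀ → Y ⊕ Z))
  have key := hP' Z₀ S D hS₀ hD₀
  rw [← entails_rename_iff hinj, ← entails_rename_iff (map_inj Function.injective_id hinj :
      Function.Injective (Sum.map id (Sum.map id Subtype.val) : X ⊕ (Y ⊕ Z₀) → X ⊕ (Y ⊕ Z))),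
    rename_union, rename_rename, rename_rename, rename_rename, rename_union, rename_rename] at key
  simp only [rename_rename, Sum.map_comp_map, map_comp_inl, map_comp_inr, CompTriple.comp_eq] at key ⊢
  exact key

/-- In the free algebra over `Y ⊕ Z`, the difference of `D` and `S` is given by finitely many
equations `E`, with `G, S ⊨ D` equivalent to `G ⊨ E`; the left deductive interpolant of `E` is the
required `P`. Premises involving `X` are first replaced by their right interpolant `Q` over `Y`,
which is why `X` is first reduced to a finite set. -/
theorem LeftUniformDeductive.leftUniformMaehara [Nonempty L.Constants] [L.IsAlgebraic] (h : V.LeftUniformDeductive)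
    (hr : V.RightUniformMaehara) (hK : ∀ A : FPAlg V, IsDualHeyting (KCon L A.carrier)) :
    V.LeftUniformMaehara := by
  refine leftUniformMaehara_of_finite fun Y Z _ _ S D hS hD => ?_
  have ha := V.isPres_presented (∅ : Set (Equation L (Y ⊕ Z)))
  let a : Y ⊕ Z → V.Presented (∅ : Set (Equation L (Y ⊕ Z))) :=
    fun x => (V.theoryCongr ∅).proj (Term.var x)
  obtain ⟨⟨d, hd⟩, hd'⟩ := (hK (V.presentedFPAlg ∅ Set.finite_empty)).exists_sdiff
    (KCon.gen (pairs a D) (finite_pairs a hD)) (KCon.gen (pairs a S) (finite_pairs a hS))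
  obtain ⟨E, hE, rfl⟩ := ha.exists_gen_eq hd
  have hE' : ∀ G : Set (Equation L (Y ⊕ Z)), G.Finite →
      (V.Entails G E ↔ V.Entails (G ∪ S) D) := by
    intro G hG
    have key := hd' _ _ (KCon.isLUB_gen_union (finite_pairs a hS) (finite_pairs a hG))
    change Congr.gen L (pairs a E) ≤ Congr.gen L (pairs a G) ↔
      Congr.gen L (pairs a D) ≤ Congr.gen L (pairs a S ∪ pairs a G) at key
    rwa [← pairs_union, ha.gen_le_gen_iff, ha.gen_le_gen_iff, Set.empty_union, Set.empty_union,
      Set.union_comm S] at key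
  obtain ⟨P, hP, hPE, hP'⟩ := h Y Z E hE
  refine ⟨P, hP, fun X _ G hG => ?_⟩
  obtain ⟨Q, hQ, hGQ⟩ := hr X Y G hG
  rw [hGQ Z S D hS hD, IsRightInterpolant.entails_iff hGQ hP, ← hE' _ (finite_rename _ hQ)]
  constructor
  · intro hQE
    have key := hP' Empty (UnivAlg.rename Sum.inr Q)
    rw [rename_rename, show (Sum.map id Sum.inl ∘ Sum.inr : Y → Empty ⊕ (Y ⊕ Z)) =
      Sum.inr ∘ Sum.inl from rfl, ← rename_rename, entails_rename_iff Sum.inr_injective,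
      entails_rename_iff Sum.inr_injective] at key
    exact key hQE
  · exact fun hQP => (hQP.rename Sum.inl).trans hPE

end Variety

end UnivAlg

namespace UnivAlg

open FirstOrder FirstOrder.Language FirstOrder.Language.Structure

variable {L : FirstOrder.Language.{u, v}} [L.IsAlgebraic] {V : Variety L}

/-! ### The category of finitely presented algebras -/

namespace FPAlg

/-- The homomorphism underlying a morphism. -/
def toHom {A B : FPAlg V} (f : A ⟶ B) : A.carrier →[L] B.carrier := f

/-- A homomorphism as a morphism. -/
def ofHom {A B : FPAlg V} (f : A.carrier →[L] B.carrier) : A ⟶ B := f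

theorem toHom_comp {A B C : FPAlg V} (f : A ⟶ B) (g : B ⟶ C) (x : A.carrier) :
    toHom (f ≫ g) x = toHom g (toHom f x) := rfl

theorem toHom_id {A : FPAlg V} (x : A.carrier) : toHom (𝟙 A) x = x := rfl

theorem hom_ext {A B : FPAlg V} {f g : A ⟶ B} (h : ∀ x, toHom f x = toHom g x) : f = g :=
  FirstOrder.Language.Hom.ext h

/-- Elements are morphisms from the free algebra on one generator, which is finitely presented. -/
theorem mono_iff {A B : FPAlg V} (f : A ⟶ B) : Mono f ↔ Function.Injective (toHom f) := by
  constructor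
  · intro hf x y hxy
    have hF := V.isPres_presented (∅ : Set (Equation L Unit))
    let F := V.presentedFPAlg (∅ : Set (Equation L Unit)) Set.finite_empty
    obtain ⟨g, hg⟩ := hF.exists_hom A.mem (f := fun _ => x) (by simp)
    obtain ⟨h, hh⟩ := hF.exists_hom A.mem (f := fun _ => y) (by simp)
    have hgh : (ofHom g : F ⟶ A) = ofHom h := by
      rw [← cancel_mono f]
      refine hF.hom_ext fun i => ?_
      change toHom f (g _) = toHom f (h _)
      rw [hg, hh, hxy]
    rw [← hg (), ← hh ()]
    exact congrArg (fun k : F ⟶ A => toHom k _) hgh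
  · intro hf
    refine ⟨fun g h hgh => hom_ext fun x => hf ?_⟩
    rw [← toHom_comp, hgh, toHom_comp]

/-- The quotient of a finitely presented algebra by a compact congruence. -/
def quotient (A : FPAlg V) (θ : Congr L A.carrier) (hθ : IsCompactElement θ) : FPAlg V where
  carrier := Quotient θ.toSetoid
  mem := A.mem.quotient θ
  finitelyPresented := by
    obtain ⟨X, _, a, S, hS, ha⟩ := FPAlg.exists_isPres A
    obtain ⟨R, hR, rfl⟩ := ha.exists_gen_eq hθ
    exact (ha.quotient R).finitelyPresented (hS.union hR)

/-- The quotient morphism. -/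
def proj (A : FPAlg V) (θ : Congr L A.carrier) (hθ : IsCompactElement θ) :
    A ⟶ A.quotient θ hθ :=
  ofHom θ.proj

theorem ker_proj (A : FPAlg V) (θ : Congr L A.carrier) (hθ : IsCompactElement θ) :
    Congr.ker (toHom (A.proj θ hθ)) = θ :=
  θ.ker_proj

theorem proj_surjective (A : FPAlg V) (θ : Congr L A.carrier) (hθ : IsCompactElement θ) :
    Function.Surjective (toHom (A.proj θ hθ)) :=
  θ.proj_surjective

theorem exists_factor {A B C : FPAlg V} (p : A ⟶ B) (hp : Function.Surjective (toHom p))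
    (q : A ⟶ C) (h : Congr.ker (toHom p) ≤ Congr.ker (toHom q)) : ∃ r : B ⟶ C, p ≫ r = q := by
  obtain ⟨r, hr⟩ := UnivAlg.exists_factor (toHom p) hp (toHom q) h
  exact ⟨ofHom r, hom_ext hr⟩

theorem epi_of_surjective {A B : FPAlg V} (p : A ⟶ B) (hp : Function.Surjective (toHom p)) :
    Epi p := by
  refine ⟨fun g h hgh => hom_ext fun y => ?_⟩
  obtain ⟨x, rfl⟩ := hp y
  rw [← toHom_comp, hgh, toHom_comp]

/-- If `n` pairs generate the kernel, then `p` is the coequalizer of the two morphisms from the free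
algebra on `n` generators that pick out their first and second components. -/
theorem isRegularEpi_of_surjective {A B : FPAlg V} (p : A ⟶ B)
    (hp : Function.Surjective (toHom p)) (hc : IsCompactElement (Congr.ker (toHom p))) :
    IsRegularEpi p := by
  obtain ⟨R, hR, hRp⟩ := Congr.exists_finite_gen_eq hc
  have : Finite R := hR
  obtain ⟨n, ⟨e⟩⟩ := Finite.exists_equiv_fin R
  have hF := V.isPres_presented (∅ : Set (Equation L (Fin n)))
  let F := V.presentedFPAlg (∅ : Set (Equation L (Fin n))) Set.finite_empty
  obtain ⟨l, hl⟩ := hF.exists_hom A.mem (f := fun i => (e.symm i).1.1) (by simp)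
  obtain ⟨r, hr⟩ := hF.exists_hom A.mem (f := fun i => (e.symm i).1.2) (by simp)
  have hker : ∀ {C : FPAlg V} (q : A ⟶ C), (ofHom l : F ⟶ A) ≫ q = ofHom r ≫ q ↔
      Congr.ker (toHom p) ≤ Congr.ker (toHom q) := by
    intro C q
    rw [← hRp, Congr.gen_le]
    constructor
    · intro h x hx
      have key := congrArg
        (fun k : F ⟶ C => toHom k ((V.theoryCongr ∅).proj (Term.var (e ⟨x, hx⟩)))) h
      change toHom q (l _) = toHom q (r _) at key
      rw [hl, hr, Equiv.symm_apply_apply] at key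
      exact key
    · intro h
      refine hF.hom_ext fun i => ?_
      change toHom q (l _) = toHom q (r _)
      rw [hl, hr]
      exact h _ (e.symm i).2
  have := epi_of_surjective p hp
  exact ⟨⟨{
    W := F
    left := ofHom l
    right := ofHom r
    w := (hker p).2 le_rfl
    isColimit := Cofork.IsColimit.ofExistsUnique fun s => by
      obtain ⟨k, hk⟩ := exists_factor p hp s.π ((hker _).1 s.condition)
      exact ⟨k, hk, fun k' hk' => (cancel_epi p).1 (hk'.trans hk.symm)⟩ }⟩⟩

/-- The source of the coequalized pair is finitely generated, so identifying the two images of each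
generator already coequalizes the pair. The coequalizer is thus the quotient by a finitely generated
congruence. -/
theorem surjective_and_isCompactElement_of_isRegularEpi {A B : FPAlg V} (p : A ⟶ B)
    (h : IsRegularEpi p) :
    Function.Surjective (toHom p) ∧ IsCompactElement (Congr.ker (toHom p)) := by
  obtain ⟨⟨W, l, r, hw, hcolim⟩⟩ := h
  have : Epi p := epi_of_isColimit_cofork hcolim
  obtain ⟨X, _, a, S, hS, ha⟩ := FPAlg.exists_isPres W
  let R := Set.range fun x => (toHom l (a x), toHom r (a x))
  have hc : IsCompactElement (Congr.gen L R) := Congr.isCompactElement_gen (Set.finite_range _)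
  have hlr : l ≫ A.proj _ hc = r ≫ A.proj _ hc := by
    refine ha.hom_ext fun x => ?_
    exact (Congr.proj_eq_iff _).2 (Congr.rel_gen (p := (toHom l (a x), toHom r (a x))) ⟨x, rfl⟩)
  obtain ⟨k, hk⟩ := exists_factor (A.proj _ hc) (A.proj_surjective _ hc) p (by
    rw [ker_proj, Congr.gen_le]
    rintro _ ⟨x, rfl⟩
    exact congrArg (fun k : W ⟶ B => toHom k (a x)) hw)
  -- The universal property of `p` gives a section `m` of `k`, so `p` and the projection have the
  -- same kernel.
  obtain ⟨m, hm⟩ : ∃ m : B ⟶ A.quotient _ hc, p ≫ m = A.proj _ hc :=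
    ⟨Cofork.IsColimit.desc hcolim _ hlr, Cofork.IsColimit.π_desc' hcolim _ hlr⟩
  have hmk : m ≫ k = 𝟙 B := by
    rw [← cancel_epi p, ← Category.assoc, hm, hk, Category.comp_id]
  have hker : Congr.ker (toHom p) = Congr.gen L R := by
    apply le_antisymm
    · intro x y hxy
      rw [← A.ker_proj _ hc, ← hm]
      exact congrArg (toHom m) hxy
    · intro x y hxy
      rw [← A.ker_proj _ hc] at hxy
      rw [← hk]
      exact congrArg (toHom k) hxy
  refine ⟨fun y => ?_, hker ▸ hc⟩
  obtain ⟨x, hx⟩ := A.proj_surjective _ hc (toHom m y)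
  refine ⟨x, ?_⟩
  rw [← hk, toHom_comp, hx, ← toHom_comp, hmk, toHom_id]

/-! ### Pushouts -/

section Pushouts

variable {A B C D : FPAlg V} {f : B ⟶ A} {g : B ⟶ C}

/-- The legs of a span have compatible finite presentations. -/
theorem exists_presented_span (f : B ⟶ A) (g : B ⟶ C) :
    ∃ (X Y Z : Type) (_ : Finite X) (_ : Finite Y) (_ : Finite Z) (a : X → A.carrier)
      (b : Y → B.carrier) (c : Z → C.carrier) (R : Set (Equation L Y))
      (S : Set (Equation L (X ⊕ Y))) (T : Set (Equation L (Y ⊕ Z))),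
      R.Finite ∧ S.Finite ∧ T.Finite ∧ V.IsPres b R ∧
        V.IsPres (Sum.elim a fun y => toHom f (b y)) S ∧
        V.IsPres (Sum.elim (fun y => toHom g (b y)) c) T := by
  obtain ⟨Y, _, b, R, hR, hb⟩ := FPAlg.exists_isPres B
  obtain ⟨X, _, a, S, hS, ha⟩ := FPAlg.exists_isPres A
  obtain ⟨Z, _, c, T, hT, hc⟩ := FPAlg.exists_isPres C
  obtain ⟨S', hS', ha'⟩ := ha.extend hS Sum.inl (Sum.elim a fun y => toHom f (b y)) fun _ => rfl
  obtain ⟨T', hT', hc'⟩ := hc.extend hT Sum.inr (Sum.elim (fun y => toHom g (b y)) c) fun _ => rfl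
  exact ⟨X, Y, Z, ‹_›, ‹_›, ‹_›, a, b, c, R, S', T', hR, hS', hT', hb, ha', hc'⟩

/-- A homomorphism out of `D` is an assignment satisfying `S` and `T`, that is, homomorphisms out of
`A` and `C` agreeing on the shared generators from `B`. -/
theorem isPushout_of_isPres {X Y Z : Type} {a : X → A.carrier} {b : Y → B.carrier}
    {c : Z → C.carrier} {d : X ⊕ (Y ⊕ Z) → D.carrier} {R : Set (Equation L Y)}
    {S : Set (Equation L (X ⊕ Y))} {T : Set (Equation L (Y ⊕ Z))} (hb : V.IsPres b R)
    (ha : V.IsPres (Sum.elim a fun y => toHom f (b y)) S)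
    (hc : V.IsPres (Sum.elim (fun y => toHom g (b y)) c) T)
    (hd : V.IsPres d (rename (Sum.map id Sum.inl) S ∪ rename Sum.inr T))
    (inl : A ⟶ D) (inr : C ⟶ D)
    (hinl : ∀ x, toHom inl (Sum.elim a (fun y => toHom f (b y)) x) = d (Sum.map id Sum.inl x))
    (hinr : ∀ x, toHom inr (Sum.elim (fun y => toHom g (b y)) c x) = d (Sum.inr x)) :
    IsPushout f g inl inr := by
  refine IsPushout.mk' ?_ (fun E k k' h₁ h₂ => hd.hom_ext fun x => ?_) fun E k k' h => ?_
  · exact hb.hom_ext fun y => (hinl (Sum.inr y)).trans (hinr (Sum.inl y)).symm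
  · rcases x with x | x
    · have := congrArg (fun k : A ⟶ E => toHom k (a x)) h₁
      have key := hinl (Sum.inl x)
      change toHom k (d (Sum.inl x)) = toHom k' (d (Sum.inl x))
      rw [← show toHom inl (a x) = d (Sum.inl x) from key]
      exact this
    · change toHom k (d (Sum.inr x)) = toHom k' (d (Sum.inr x))
      rw [← hinr x]
      exact congrArg (fun k : C ⟶ E => toHom k _) h₂
  · have hy : ∀ y, toHom k (toHom f (b y)) = toHom k' (toHom g (b y)) := fun y =>
      congrArg (fun k : B ⟶ E => toHom k (b y)) h
    let e : X ⊕ (Y ⊕ Z) → E.carrier :=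
      Sum.elim (fun x => toHom k (a x)) fun x => toHom k' (Sum.elim (fun y => toHom g (b y)) c x)
    have he : e ∘ Sum.map id Sum.inl =
        fun x => toHom k (Sum.elim a (fun y => toHom f (b y)) x) := by
      funext x
      rcases x with x | y
      exacts [rfl, (hy y).symm]
    obtain ⟨m, hm⟩ := hd.exists_hom E.mem (f := e) (by
      rintro ε (hε | hε)
      · revert ε
        rw [holds_rename, he]
        exact fun ε hε => (ha.holds ε hε).map (toHom k)
      · revert ε
        rw [holds_rename]
        exact fun ε hε => (hc.holds ε hε).map (toHom k'))
    refine ⟨ofHom m, ha.hom_ext fun x => ?_, hc.hom_ext fun x => ?_⟩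
    · change m (toHom inl _) = toHom k _
      rw [hinl, hm]
      exact congrFun he x
    · change m (toHom inr _) = toHom k' _
      rw [hinr, hm]
      rfl

theorem exists_isPushout_presented {X Y Z : Type} [Finite X] [Finite Y] [Finite Z]
    {a : X → A.carrier} {b : Y → B.carrier} {c : Z → C.carrier} {R : Set (Equation L Y)}
    {S : Set (Equation L (X ⊕ Y))} {T : Set (Equation L (Y ⊕ Z))} (hS : S.Finite) (hT : T.Finite)
    (hb : V.IsPres b R) (ha : V.IsPres (Sum.elim a fun y => toHom f (b y)) S)
    (hc : V.IsPres (Sum.elim (fun y => toHom g (b y)) c) T) :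
    ∃ (D : FPAlg V) (d : X ⊕ (Y ⊕ Z) → D.carrier) (inl : A ⟶ D) (inr : C ⟶ D),
      V.IsPres d (rename (Sum.map id Sum.inl) S ∪ rename Sum.inr T) ∧ IsPushout f g inl inr ∧
      ∀ x, toHom inr (Sum.elim (fun y => toHom g (b y)) c x) = d (Sum.inr x) := by
  have hd := V.isPres_presented (rename (Sum.map id Sum.inl) S ∪ rename Sum.inr T)
  let D := V.presentedFPAlg (rename (Sum.map id Sum.inl) S ∪ rename Sum.inr T)
    ((finite_rename _ hS).union (finite_rename _ hT))
  obtain ⟨inl, hinl⟩ := ha.exists_hom hd.mem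
    (holds_rename.1 fun e he => hd.holds e (Or.inl he))
  obtain ⟨inr, hinr⟩ := hc.exists_hom hd.mem
    (holds_rename.1 fun e he => hd.holds e (Or.inr he))
  exact ⟨D, _, ofHom inl, ofHom inr, hd,
    isPushout_of_isPres hb ha hc hd (D := D) (ofHom inl) (ofHom inr) hinl hinr, hinr⟩

end Pushouts

theorem hasFiniteColimits : HasFiniteColimits (FPAlg V) := by
  have : HasInitial (FPAlg V) := by
    have hF := V.isPres_presented (∅ : Set (Equation L Empty))
    refine IsInitial.hasInitial (X := V.presentedFPAlg (∅ : Set (Equation L Empty))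
      Set.finite_empty) (IsInitial.ofUniqueHom (fun A =>
        (hF.exists_hom A.mem (f := Empty.elim) (by simp)).choose) fun A m => ?_)
    exact hF.hom_ext fun x => x.elim
  have : HasPushouts (FPAlg V) := by
    have : ∀ {A B C : FPAlg V} {f : B ⟶ A} {g : B ⟶ C}, HasColimit (span f g) := by
      intro A B C f g
      obtain ⟨X, Y, Z, _, _, _, a, b, c, R, S, T, hR, hS, hT, hb, ha, hc⟩ :=
        exists_presented_span f g
      obtain ⟨D, d, inl, inr, -, h, -⟩ := exists_isPushout_presented hS hT hb ha hc
      exact h.hasPushout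
    exact hasPushouts_of_hasColimit_span _
  exact hasFiniteColimits_of_hasInitial_and_pushouts

/-! ### Regular subobjects in the opposite category -/

/-- The compact congruence corresponding to a regular subobject. -/
noncomputable def kerArrow {X : (FPAlg V)ᵒᵖ} (S : RegSubobject X) : KCon L X.unop.carrier :=
  ⟨Congr.ker (toHom S.1.arrow.unop), (surjective_and_isCompactElement_of_isRegularEpi _
    ((isRegularMono_op_iff_isRegularEpi S.1.arrow.unop).1 S.2)).2⟩

theorem arrow_surjective {X : (FPAlg V)ᵒᵖ} (S : RegSubobject X) :
    Function.Surjective (toHom S.1.arrow.unop) :=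
  (surjective_and_isCompactElement_of_isRegularEpi _
    ((isRegularMono_op_iff_isRegularEpi S.1.arrow.unop).1 S.2)).1

/-- In the opposite category a regular subobject is a surjection, and one surjection factors through
another exactly when the kernels are included. With `kerArrow_surjective` this makes `kerArrow` an
order anti-isomorphism. -/
theorem kerArrow_le_iff {X : (FPAlg V)ᵒᵖ} {S T : RegSubobject X} :
    kerArrow S ≤ kerArrow T ↔ T ≤ S := by
  constructor
  · intro h
    obtain ⟨k, hk⟩ := exists_factor S.1.arrow.unop (arrow_surjective S) T.1.arrow.unop h
    exact Subobject.le_of_comm k.op (Quiver.Hom.unop_inj hk)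
  · intro h x y hxy
    have hle : T.1 ≤ S.1 := h
    have := Subobject.ofLE_arrow hle
    change toHom T.1.arrow.unop x = toHom T.1.arrow.unop y
    rw [← this]
    exact congrArg (toHom (Subobject.ofLE T.1 S.1 hle).unop) hxy

theorem ker_comp_le {A B C : FPAlg V} (f : A ⟶ B) (g : B ⟶ C) :
    Congr.ker (toHom f) ≤ Congr.ker (toHom (f ≫ g)) :=
  fun _ _ h => congrArg (toHom g) h

theorem kerArrow_surjective {X : (FPAlg V)ᵒᵖ} (θ : KCon L X.unop.carrier) :
    ∃ S : RegSubobject X, kerArrow S = θ := by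
  let p := X.unop.proj θ.1 θ.2
  have hp : IsRegularEpi p := isRegularEpi_of_surjective p (X.unop.proj_surjective _ _)
    ((X.unop.ker_proj θ.1 θ.2).symm ▸ θ.2)
  have hm : IsRegularMono p.op := (isRegularMono_op_iff_isRegularEpi p).2 hp
  have : Mono p.op := inferInstance
  have h₁ : (Subobject.underlyingIso p.op).hom ≫ p.op = (Subobject.mk p.op).arrow :=
    Subobject.underlyingIso_hom_comp_eq_mk p.op
  have h₂ := Subobject.underlyingIso_arrow p.op
  refine ⟨⟨Subobject.mk p.op, ?_⟩, Subtype.ext ?_⟩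
  · rw [← h₁]
    exact (MorphismProperty.cancel_left_of_respectsIso (MorphismProperty.regularMono _) _ _).2 hm
  · change Congr.ker (toHom (Subobject.mk p.op).arrow.unop) = θ.1
    refine Eq.trans ?_ (X.unop.ker_proj θ.1 θ.2)
    -- The chosen representative of the subobject differs from `p.op` by an isomorphism, which does
    -- not change the kernel; each half is a factorization.
    apply le_antisymm
    · have h := ker_comp_le (Subobject.mk p.op).arrow.unop (Subobject.underlyingIso p.op).inv.unop
      rw [← unop_comp, h₂] at h
      exact h
    · have h := ker_comp_le p (Subobject.underlyingIso p.op).hom.unop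
      rw [← h₁]
      exact h

/-- The pullback is a pushout of algebras. The quotient by the image congruence completes the
square, so the pushout maps to it, which bounds the kernel from above; commutativity of the square
bounds it from below. -/
theorem kerArrow_pullback [HasPullbacks (FPAlg V)ᵒᵖ] {X Y : (FPAlg V)ᵒᵖ} (f : X ⟶ Y)
    (S : RegSubobject Y) :
    (kerArrow (RegSubobject.pullback f S)).1 = (kerArrow S).1.map (toHom f.unop) := by
  have hpb := (Subobject.isPullback f S.1).unop
  change Congr.ker (toHom ((Subobject.pullback f).obj S.1).arrow.unop) = _
  apply le_antisymm
  · have hc : IsCompactElement ((kerArrow S).1.map (toHom f.unop)) :=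
      Congr.isCompactElement_map _ (kerArrow S).2
    let q := X.unop.proj _ hc
    obtain ⟨k, hk⟩ := exists_factor S.1.arrow.unop (arrow_surjective S) (f.unop ≫ q) (by
      intro x y hxy
      exact (Congr.proj_eq_iff _).2 (Congr.map_le.1 le_rfl x y hxy))
    have h := ker_comp_le ((Subobject.pullback f).obj S.1).arrow.unop
      (hpb.desc q k hk.symm)
    rw [hpb.inl_desc, ker_proj] at h
    exact h
  · rw [Congr.map_le]
    intro x y hxy
    have hw := fun x => congrArg (fun k : Y.unop ⟶ _ => toHom k x) hpb.w
    change toHom (f.unop ≫ ((Subobject.pullback f).obj S.1).arrow.unop) x =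
      toHom (f.unop ≫ ((Subobject.pullback f).obj S.1).arrow.unop) y
    rw [hpb.w]
    exact congrArg (toHom (Subobject.pullbackπ f S.1).unop) hxy

/-! ### The r-Heyting axioms dualized -/

variable (V) in
/-- Being r-Heyting in terms of algebras. -/
structure DualRHeyting : Prop where
  isCompactElement_ker : ∀ {A B : FPAlg V} (h : A ⟶ B), IsCompactElement (Congr.ker (toHom h))
  injective_of_isPushout : ∀ {A B C D : FPAlg V} {f : B ⟶ A} {g : B ⟶ C} {inl : A ⟶ D}
    {inr : C ⟶ D}, IsPushout f g inl inr → Function.Injective (toHom f) →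
      Function.Injective (toHom inr)
  hasFiniteMeets : ∀ A : FPAlg V, HasFiniteMeets (KCon L A.carrier)
  exists_least : ∀ {A B : FPAlg V} (h : B ⟶ A) (ψ : KCon L A.carrier), ∃ φ₀ : KCon L B.carrier,
    ∀ φ : KCon L B.carrier, φ₀ ≤ φ ↔ ψ.1 ≤ φ.1.map (toHom h)

/-- The conditions match one by one: factorizations with compact kernels, stability of epimorphisms
with injectivity in pushouts, joins with meets, and right adjoints with least congruences. -/
theorem isRHeyting_op_iff : IsRHeyting (FPAlg V)ᵒᵖ ↔ DualRHeyting V := by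
  constructor
  · intro H
    have := H.hasFiniteLimits
    refine ⟨fun {A B} h => ?_, fun {A B C D f g inl inr} hpo hf => ?_, fun A s hs => ?_,
      fun {A B} h ψ => ?_⟩
    -- Dually, `h` is a regular epimorphism followed by an injection, so it has the compact kernel
    -- of the former.
    · obtain ⟨I, e, m, he, hm, hem⟩ := H.exists_factorization h.op
      have hm' := (surjective_and_isCompactElement_of_isRegularEpi m.unop
        ((isRegularMono_op_iff_isRegularEpi m.unop).1 hm)).2
      have he' : Function.Injective (toHom e.unop) := (mono_iff _).1 inferInstance
      have hem' : m.unop ≫ e.unop = h := congrArg Quiver.Hom.unop hem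
      have : Congr.ker (toHom h) = Congr.ker (toHom m.unop) := by
        rw [← hem']
        ext x y
        exact he'.eq_iff
      rwa [this]
    · have := (mono_iff f).2 hf
      have hepi : Epi inr.op := H.epi_stable.of_isPullback hpo.flip.op
        (show Epi f.op from inferInstance)
      exact (mono_iff inr).1 (show Mono inr.op.unop from inferInstance)
    · choose S hS using fun θ : KCon L A.carrier => kerArrow_surjective (X := Opposite.op A) θ
      obtain ⟨j, hj⟩ := H.finite_joins (Opposite.op A) (S '' s) (hs.image S)
      refine ⟨kerArrow j, fun θ hθ => ?_, fun θ hθ => ?_⟩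
      · rw [← hS θ, kerArrow_le_iff]
        exact hj.1 ⟨θ, hθ, rfl⟩
      · rw [← hS θ, kerArrow_le_iff]
        refine hj.2 ?_
        rintro _ ⟨χ, hχ, rfl⟩
        rw [← kerArrow_le_iff, hS, hS]
        exact hθ hχ
    · obtain ⟨g, hg⟩ := H.exists_right_adjoint h.op
      obtain ⟨T, rfl⟩ := kerArrow_surjective (X := Opposite.op A) ψ
      -- The Galois connection, read through the anti-isomorphism, makes the right adjoint of `T`
      -- the least congruence sought.
      refine ⟨kerArrow (g T), fun φ => ?_⟩
      obtain ⟨S, rfl⟩ := kerArrow_surjective (X := Opposite.op B) φ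
      rw [kerArrow_le_iff, ← hg S T, ← kerArrow_le_iff]
      have hpb : (kerArrow (RegSubobject.pullback h.op S)).1 = (kerArrow S).1.map (toHom h) :=
        kerArrow_pullback h.op S
      rw [← hpb]
      rfl
  · intro H
    have hcolim := hasFiniteColimits (V := V)
    refine { hasFiniteLimits := inferInstance, exists_factorization := fun {X Y} f => ?_,
             epi_stable := ⟨fun {X Y Y' S f g f' g'} sq hg => ?_⟩,
             finite_joins := fun X s hs => ?_, exists_right_adjoint := fun {X Y} f => ?_ }
    · let p := Y.unop.proj _ (H.isCompactElement_ker f.unop)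
      have hps := Y.unop.proj_surjective _ (H.isCompactElement_ker f.unop)
      have hpk := Y.unop.ker_proj _ (H.isCompactElement_ker f.unop)
      obtain ⟨k, hk⟩ := exists_factor p hps f.unop hpk.le
      have hk' : Mono k := (mono_iff k).2 fun x y hxy => by
        obtain ⟨x, rfl⟩ := hps x
        obtain ⟨y, rfl⟩ := hps y
        rw [← toHom_comp, ← toHom_comp, hk] at hxy
        exact hpk.ge x y hxy
      refine ⟨_, k.op, p.op, inferInstance, (isRegularMono_op_iff_isRegularEpi p).2 ?_,
        congrArg Quiver.Hom.op hk⟩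
      exact isRegularEpi_of_surjective p hps (hpk.symm ▸ H.isCompactElement_ker f.unop)
    · have hg' : Epi g := hg
      have := H.injective_of_isPushout sq.unop.flip ((mono_iff g.unop).1 inferInstance)
      have := (mono_iff g'.unop).2 this
      exact (show Epi g'.unop.op from inferInstance)
    · obtain ⟨m, hm⟩ := H.hasFiniteMeets X.unop (kerArrow '' s) (hs.image _)
      obtain ⟨S, rfl⟩ := kerArrow_surjective m
      refine ⟨S, fun T hT => kerArrow_le_iff.1 (hm.1 ⟨T, hT, rfl⟩), fun T hT =>
        kerArrow_le_iff.1 (hm.2 ?_)⟩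
      rintro _ ⟨U, hU, rfl⟩
      exact kerArrow_le_iff.2 (hT hU)
    · choose φ hφ using fun T : RegSubobject X => H.exists_least f.unop (kerArrow T)
      choose g hg using fun T : RegSubobject X => kerArrow_surjective (φ T)
      refine ⟨g, fun S T => ?_⟩
      rw [← kerArrow_le_iff, ← kerArrow_le_iff, hg, hφ, ← kerArrow_pullback]
      rfl

end FPAlg

end UnivAlg

namespace UnivAlg

open FirstOrder FirstOrder.Language FirstOrder.Language.Structure

variable {L : FirstOrder.Language.{u, v}} {V : Variety L}

/-! ### r-Heyting categories and Maehara interpolation -/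

namespace Variety

theorem IsPres.entails_iff {X : Type} {A : Type u} [L.Structure A] {a : X → A}
    {S : Set (Equation L X)} (h : V.IsPres a S) {D : Set (Equation L X)} :
    V.Entails S D ↔ ∀ e ∈ D, e.Holds a := by
  rw [Variety.entails_iff]
  exact forall₂_congr fun e _ => (h.holds_iff e).symm

/-- Consequences in a subset of the generators are tested by the restricted assignment. -/
theorem IsPres.entails_rename_iff {X Y : Type} {A : Type u} [L.Structure A] {a : X → A}
    {S : Set (Equation L X)} (h : V.IsPres a S) {g : Y → X} {D : Set (Equation L Y)} :
    V.Entails S (UnivAlg.rename g D) ↔ ∀ e ∈ D, e.Holds (a ∘ g) := by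
  rw [h.entails_iff, holds_rename]

end Variety

namespace FPAlg

open Variety

theorem map_gen_pairs {X : Type*} {A B : Type*} [L.Structure A] [L.Structure B] (h : A →[L] B)
    (a : X → A) (R : Set (Equation L X)) :
    (Congr.gen L (pairs a R)).map h = Congr.gen L (pairs (fun x => h (a x)) R) := by
  rw [Congr.map_gen]
  unfold pairs
  rw [Set.image_image]
  simp only [realize_comp_hom, Prod.map]

theorem pairs_rename {X Y A : Type*} [L.Structure A] (a : Y → A) (g : X → Y)
    (R : Set (Equation L X)) : pairs a (rename g R) = pairs (a ∘ g) R := by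
  unfold pairs rename
  rw [Set.image_image]
  simp only [Term.realize_relabel]

variable [L.IsAlgebraic]

/-- Let `A` be presented by `G`, and let `P` generate the kernel of the map from the free algebra
over `Y` to `A`. The algebra `B` presented by `P` embeds into `A`, so the algebra `C` presented by
`P` and the side equations embeds into the pushout, where the premises hold. -/
theorem DualRHeyting.rightUniformMaehara [Nonempty L.Constants] (H : DualRHeyting V) :
    V.RightUniformMaehara := by
  refine rightUniformMaehara_of_finite fun X Y _ _ G hG => ?_
  obtain ⟨A, a, hA⟩ := V.exists_fpAlg_isPres hG
  obtain ⟨F, b₀, hF⟩ := V.exists_fpAlg_isPres (Set.finite_empty : (∅ : Set (Equation L Y)).Finite)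
  obtain ⟨h, hh⟩ := hF.exists_hom hA.mem (f := a ∘ Sum.inr) (by simp)
  have hh : (fun y => h (b₀ y)) = a ∘ Sum.inr := funext hh
  obtain ⟨P, hP, hPh⟩ := hF.exists_gen_eq
    (θ := Congr.ker h) (H.isCompactElement_ker (ofHom h : F ⟶ A))
  have hPe : ∀ e : Equation L Y, e.Holds (a ∘ Sum.inr) ↔ V.Entails P {e} := by
    intro e
    unfold Equation.Holds
    rw [← Set.empty_union P, ← hF.gen_rel_iff, hPh, ← hh, realize_comp_hom h, realize_comp_hom h]
    rfl
  have hPa : ∀ e ∈ P, e.Holds (a ∘ Sum.inr) := fun e he =>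
    (hPe e).2 (Entails.of_subset (by simpa using he))
  obtain ⟨B, b, hB⟩ := V.exists_fpAlg_isPres hP
  obtain ⟨f, hf⟩ := hB.exists_hom hA.mem hPa
  have hf : (fun y => f (b y)) = a ∘ Sum.inr := funext hf
  have hfinj : Function.Injective f := by
    intro x y hxy
    obtain ⟨t, rfl⟩ := hB.surj x
    obtain ⟨s, rfl⟩ := hB.surj y
    rw [← realize_comp_hom f, ← realize_comp_hom f] at hxy
    rw [hf] at hxy
    exact hB.realize_eq_iff.2 ((hPe (t, s)).1 hxy)
  refine ⟨P, hP, fun Z _ S D hS hD => ⟨fun hD' => ?_, ?_⟩⟩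
  · let T := rename Sum.inl P ∪ S
    have hT : T.Finite := (finite_rename _ hP).union hS
    obtain ⟨C, c, hC⟩ := V.exists_fpAlg_isPres hT
    obtain ⟨g, hg⟩ := hB.exists_hom hC.mem (f := c ∘ Sum.inl)
      (holds_rename.1 fun e he => hC.holds e (Or.inl he))
    have ha : Sum.elim (a ∘ Sum.inl) (fun y => f (b y)) = a := by
      rw [hf, Sum.elim_comp_inl_inr]
    have hc : Sum.elim (fun y => g (b y)) (c ∘ Sum.inr) = c := by
      rw [show (fun y => g (b y)) = c ∘ Sum.inl from funext hg, Sum.elim_comp_inl_inr]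
    obtain ⟨E, d, inl, inr, hd, hpo, hinr⟩ := exists_isPushout_presented
      (f := (ofHom f : B ⟶ A)) (g := (ofHom g : B ⟶ C)) (a := a ∘ Sum.inl) (b := b)
      (c := c ∘ Sum.inr) hG hT hB (ha.symm ▸ hA) (hc.symm ▸ hC)
    have hinj := H.injective_of_isPushout hpo hfinj
    have hinr' : d ∘ Sum.inr = fun x => toHom inr (c x) := by
      funext x
      rw [Function.comp_apply, ← hinr]
      exact congrArg (fun c => toHom inr (c x)) hc
    -- The relations of `C` include `P` besides `S`; enlarging the premises is harmless.
    have key := hD'.mono (T := rename (Sum.map id Sum.inl) G ∪ rename Sum.inr T)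
      (Set.union_subset_union_right _ (Set.image_mono Set.subset_union_right))
    rw [hd.entails_rename_iff, hinr'] at key
    exact hC.entails_iff.2 fun e he => (Equation.holds_map_iff hinj).1 (key e he)
  · exact (hA.entails_rename_iff.2 hPa).union_rename

/-- The interpolant is the least congruence on the free algebra over `Y` whose image in the algebra
presented by `S` lies above that of `D`. It is tested against the right interpolant `Q` of `G`. -/
theorem DualRHeyting.leftUniformMaehara [Nonempty L.Constants] (H : DualRHeyting V) :
    V.LeftUniformMaehara := by
  refine leftUniformMaehara_of_finite fun Y Z _ _ S D hS hD => ?_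
  obtain ⟨B, b, hB⟩ := V.exists_fpAlg_isPres (Set.finite_empty : (∅ : Set (Equation L Y)).Finite)
  obtain ⟨A, a, hA⟩ := V.exists_fpAlg_isPres hS
  obtain ⟨h, hh⟩ := hB.exists_hom hA.mem (f := a ∘ Sum.inl) (by simp)
  have hh : (fun y => h (b y)) = a ∘ Sum.inl := funext hh
  obtain ⟨⟨φ₀, hφ₀⟩, hφ⟩ := H.exists_least (ofHom h : B ⟶ A)
    (KCon.gen (pairs a D) (finite_pairs a hD))
  obtain ⟨P, hP, rfl⟩ := hB.exists_gen_eq hφ₀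
  refine ⟨P, hP, fun X _ G hG => ?_⟩
  obtain ⟨Q, hQ, hGQ⟩ := H.rightUniformMaehara X Y G hG
  rw [hGQ Z S D hS hD, IsRightInterpolant.entails_iff hGQ hP]
  have key := hφ (KCon.gen (pairs b Q) (finite_pairs b hQ))
  change Congr.gen L (pairs b P) ≤ Congr.gen L (pairs b Q) ↔
    Congr.gen L (pairs a D) ≤ (Congr.gen L (pairs b Q)).map h at key
  rw [map_gen_pairs, hh, ← pairs_rename, hA.gen_le_gen_iff, hB.gen_le_gen_iff, Set.empty_union,
    Set.union_comm] at key
  exact key.symm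

theorem dualRHeyting_of_maehara [Nonempty L.Constants] (hl : V.LeftUniformMaehara)
    (hr : V.RightUniformMaehara) (hm : ∀ A : FPAlg V, HasFiniteMeets (KCon L A.carrier)) :
    DualRHeyting V := by
  refine ⟨fun {A B} h => ?_, fun {A B C D f g inl inr} hpo hf => ?_, hm, fun {A B} h ψ => ?_⟩
  · obtain ⟨Y, _, a, R, hR, ha⟩ := A.exists_isPres
    obtain ⟨X, _, b, S, hS, hb⟩ := B.exists_isPres
    obtain ⟨S, hS, hb⟩ := hb.extend hS Sum.inl (Sum.elim b fun y => toHom h (a y)) fun _ => rfl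
    obtain ⟨P, hP, hSP⟩ := hr X Y S hS
    have hSP : V.IsRightInterpolant S P := hSP
    have hPe : ∀ e : Equation L Y, e.Holds (fun y => toHom h (a y)) ↔ V.Entails P {e} := by
      intro e
      rw [← hSP.entails_iff (Set.finite_singleton e), hb.entails_rename_iff, Sum.elim_comp_inr]
      simp
    -- The right interpolant of the relations of `B` axiomatizes all equations true of the images of
    -- the generators of `A`, hence generates the kernel.
    have hker : Congr.ker (toHom h) = Congr.gen L (pairs a P) := by
      apply le_antisymm
      · intro x y hxy
        obtain ⟨t, rfl⟩ := ha.surj x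
        obtain ⟨s, rfl⟩ := ha.surj y
        rw [ha.gen_rel_iff]
        refine ((hPe (t, s)).1 ?_).mono Set.subset_union_right
        unfold Equation.Holds
        rw [realize_comp_hom, realize_comp_hom]
        exact hxy
      · rw [Congr.gen_le]
        rintro _ ⟨e, he, rfl⟩
        have key := (hPe e).2 (Entails.of_subset (by simpa using he))
        unfold Equation.Holds at key
        rw [realize_comp_hom, realize_comp_hom] at key
        exact key
    exact hker ▸ Congr.isCompactElement_gen (finite_pairs a hP)
  · obtain ⟨X, Y, Z, _, _, _, a, b, c, R, S, T, hR, hS, hT, hb, ha, hc⟩ := exists_presented_span f g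
    obtain ⟨P, hP, hSP⟩ := hr X Y S hS
    obtain ⟨E, d, inl', inr', hd, hpo', hinr'⟩ := exists_isPushout_presented hS hT hb ha hc
    -- Injectivity of `f` pulls the interpolant back to `B`, and `g` carries it to `C`. An equation
    -- between elements of `C` that holds in the pushout follows from `P` and `T`, both of which
    -- hold in `C`.
    have hPb : ∀ e ∈ P, e.Holds b := by
      have key := (IsRightInterpolant.entails_iff hSP hP).2 (Entails.of_subset subset_rfl)
      rw [ha.entails_rename_iff, Sum.elim_comp_inr] at key
      exact fun e he => (Equation.holds_map_iff hf).1 (key e he)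
    have hinj : Function.Injective (toHom inr') := by
      intro x y hxy
      obtain ⟨t, rfl⟩ := hc.surj x
      obtain ⟨s, rfl⟩ := hc.surj y
      have key : V.Entails (rename (Sum.map id Sum.inl) S ∪ rename Sum.inr T)
          (rename Sum.inr {(t, s)}) := by
        rw [hd.entails_rename_iff, show d ∘ Sum.inr =
          fun x => toHom inr' (Sum.elim (fun y => toHom g (b y)) c x) from
            (funext hinr').symm]
        rintro _ rfl
        unfold Equation.Holds
        rwa [realize_comp_hom, realize_comp_hom]
      rw [hSP Z T {(t, s)} hT (Set.finite_singleton _)] at key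
      refine key _ C.mem _ ?_ _ rfl
      rintro e (he | he)
      · revert e
        rw [holds_rename, Sum.elim_comp_inl]
        exact fun e he => (hPb e he).map (toHom g)
      · exact hc.holds e he
    intro x y hxy
    -- The injection into the presented pushout factors through the given one.
    apply hinj
    rw [← hpo.inr_desc inl' inr' hpo'.w, toHom_comp, toHom_comp, hxy]
  · obtain ⟨Y, _, b, R, hR, hb⟩ := B.exists_isPres
    obtain ⟨Z, _, c, T, hT, hc⟩ := A.exists_isPres
    obtain ⟨T, hT, ha⟩ := hc.extend hT Sum.inr (Sum.elim (fun y => toHom h (b y)) c) fun _ => rfl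
    obtain ⟨ψ, hψ⟩ := ψ
    obtain ⟨D, hD, rfl⟩ := ha.exists_gen_eq hψ
    -- The relations of `A` serve as side equations, so the interpolant describes the least
    -- congruence on `B`.
    obtain ⟨P, hP, hP'⟩ := hl Y Z T D hT hD
    refine ⟨KCon.gen (pairs b P) (finite_pairs b hP), fun φ => ?_⟩
    obtain ⟨φ, hφ⟩ := φ
    obtain ⟨Q, hQ, rfl⟩ := hb.exists_gen_eq hφ
    change Congr.gen L (pairs b P) ≤ Congr.gen L (pairs b Q) ↔
      Congr.gen L (pairs (Sum.elim (fun y => toHom h (b y)) c) D) ≤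
        (Congr.gen L (pairs b Q)).map (toHom h)
    have hpairs : pairs (fun y => toHom h (b y)) Q =
        pairs (Sum.elim (fun y => toHom h (b y)) c) (rename Sum.inl Q) := by
      rw [pairs_rename, Sum.elim_comp_inl]
    rw [map_gen_pairs, hpairs, hb.gen_le_gen_iff, ha.gen_le_gen_iff]
    have key := hP' Empty (rename Sum.inr (R ∪ Q)) (finite_rename _ (hR.union hQ))
    rw [Variety.entails_rename_iff Sum.inr_injective, rename_rename,
      show (Sum.map id Sum.inl ∘ Sum.inr : Y → Empty ⊕ (Y ⊕ Z)) = Sum.inr ∘ Sum.inl from rfl,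
      ← rename_rename, ← rename_union, Variety.entails_rename_iff Sum.inr_injective] at key
    rw [← key, rename_union]
    -- The relations `R` of `B` are preserved by `h`, so they may be dropped in the presence of `T`.
    have hTR : V.Entails T (rename Sum.inl R) := by
      rw [ha.entails_rename_iff, Sum.elim_comp_inl]
      exact fun e he => (hb.holds e he).map (toHom h)
    constructor
    · exact (((hTR.mono Set.subset_union_left).union
        (Entails.of_subset Set.subset_union_right)).union
          (Entails.of_subset Set.subset_union_left)).trans
    · exact fun H => H.mono (Set.union_subset Set.subset_union_right
        (Set.subset_union_right.trans Set.subset_union_left))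

end FPAlg

end UnivAlg

/-! ### The equivalence -/

theorem proposition5p6 (L : FirstOrder.Language.{u, v}) [L.IsAlgebraic] [Nonempty L.Constants]
    (V : UnivAlg.Variety L) (hCEP : V.CongruenceExtension) :
    List.TFAE [
      UnivAlg.IsRHeyting (UnivAlg.FPAlg V)ᵒᵖ,
      V.LeftUniformDeductive ∧ V.RightUniformDeductive ∧
        ∀ A : UnivAlg.FPAlg V, UnivAlg.IsDualHeyting (UnivAlg.KCon L A.carrier),
      V.LeftUniformMaehara ∧ V.RightUniformMaehara ∧
        ∀ A : UnivAlg.FPAlg V, UnivAlg.HasFiniteMeets (UnivAlg.KCon L A.carrier)] := by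
  tfae_have 1 ↔ 3 := by
    rw [UnivAlg.FPAlg.isRHeyting_op_iff]
    exact ⟨fun H => ⟨H.leftUniformMaehara, H.rightUniformMaehara, H.hasFiniteMeets⟩,
      fun ⟨hl, hr, hm⟩ => UnivAlg.FPAlg.dualRHeyting_of_maehara hl hr hm⟩
  tfae_have 3 → 2 := fun ⟨hl, hr, hm⟩ =>
    ⟨hl.leftUniformDeductive, hr.rightUniformDeductive, fun A => hl.isDualHeyting A (hm A)⟩
  tfae_have 2 → 3 := fun ⟨hl, hr, hK⟩ =>
    have hr' := hr.rightUniformMaehara hCEP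
    ⟨hl.leftUniformMaehara hr' hK, hr', fun A => (hK A).hasFiniteMeets⟩
  tfae_finish
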